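/- Let $X=[-\tfrac12,\tfrac12)$, let $G=\frac{\sqrt5+1}{2}$, and let $T\colon X\to X$ be the nearest integer continued fraction map, $T(0)=0$ and $T(x)=\frac{\epsilon}{x}-\left\lfloor\frac{\epsilon}{x}+\frac12\right\rfloor$ for $x\neq0$, where $\epsilon$ is the sign of $x$. For $x\in X$ let $b_1(x)=\left\lfloor\left|\frac1x\right|+\frac12\right\rfloor$ and $b_i(x)=b_1(T^{i-1}(x))$, $i\ge1$, be its digits (with $b_1(0)=0$, say, which only matters on a null set). Let $\mu_N$ be the $T$-invariant probability measure on $X$ with density $\frac{1}{\log G}\frac{1}{G+x}$ on $[0,\frac12)$ and $\frac{1}{\log G}\frac{1}{G+1+x}$ on $[-\frac12,0)$. For $n\ge1$ and $v\in\mathbb R$ put $S_n(x,v)=\#\{i\in\{1,\dots,n\}: b_i(x)>v\}$ and $M_n(x)=\max_{1\le i\le n}b_i(x)$, and for $1\le k\le n$ let $M_n^{(k)}(x)$ be the $k$-th largest among $b_1(x),\dots,b_n(x)$, counted with multiplicity. Let $u_n(r)=\frac{nr}{\log G}$, let $\theta=\frac34$, and for $n\ge1$ let $l_n$ be the real number with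 $l_n\theta^{-l_n}=n$. Then there is an absolute constant $C>0$ such that for all $n\ge1$ and all $r>0$: 1. for all integers $j\ge0$, $\displaystyle\left|\mu_N\{x\in X: S_n(x,u_n(r))=j\}-e^{-1/r}\frac{r^{-j}}{j!}\right|\le \frac{C}{\min(r,r^2)}\,\frac{l_n}{n}$; 2. for all integers $1\le k\le n$, $\displaystyle\left|\mu_N\{x\in X: M_n^{(k)}(x)\le u_n(r)\}-e^{-1/r}\sum_{j=0}^{k-1}\frac{r^{-j}}{j!}\right|\le \frac{C}{\min(r,r^2)}\,\frac{l_n}{n}$; 3. in particular, $\displaystyle\left|\mu_N\{x\in X: M_n(x)\le u_n(r)\}-e^{-1/r}\right|\le \frac{C}{\min(r,r^2)}\,\frac{l_n}{n}$. -/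

import Mathlib

open MeasureTheory

namespace NICF

noncomputable section

/-- The fundamental domain `[-1/2, 1/2)`. -/
def X : Set ℝ := Set.Ico (-(1 / 2)) (1 / 2)

/-- The nearest integer continued fraction map
`T x = ε / x - ⌊ε / x + 1/2⌋` for `x ≠ 0` (with `ε` the sign of `x`), and `T 0 = 0`.
It takes all its values in `X`. -/
def T (x : ℝ) : ℝ :=
  if x = 0 then 0 else Real.sign x / x - ⌊Real.sign x / x + 1 / 2⌋

/-- The first digit `b₁ x = ⌊|1 / x| + 1/2⌋`, the nearest integer to `|1 / x|`, so that
`x = ε / (b₁ x + T x)` for `x ≠ 0`. (At `x = 0` there is no digit; the value there is `0`.) -/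
def firstDigit (x : ℝ) : ℕ := ⌊|1 / x| + 1 / 2⌋₊

/-- The `i`-th digit `b_i x = b₁ (T^{i-1} x)`, for `i ≥ 1`. -/
def digit (i : ℕ) (x : ℝ) : ℕ := firstDigit (T^[i - 1] x)

/-- The density of the invariant measure, on `X`; `G` is the golden ratio. -/
def density (x : ℝ) : ℝ :=
  if 0 ≤ x then 1 / Real.log Real.goldenRatio * (1 / (Real.goldenRatio + x))
  else 1 / Real.log Real.goldenRatio * (1 / (Real.goldenRatio + 1 + x))

/-- The invariant measure on `X`, seen as a measure on `ℝ` that gives no mass to the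
complement of `X`. -/
def mu : Measure ℝ :=
  (volume.restrict X).withDensity fun x => ENNReal.ofReal (density x)

/-- `S n x v = #{i ∈ {1, …, n} : b_i x > v}`, the number of exceedances of the level `v`. -/
def S (n : ℕ) (x v : ℝ) : ℕ :=
  ((Finset.Icc 1 n).filter fun i => v < (digit i x : ℝ)).card

/-- The maximum of `b_1 x, …, b_n x`, for `n ≥ 1`. -/
def M (n : ℕ) (x : ℝ) : ℕ := (Finset.Icc 1 n).sup fun i => digit i x

/-- The `k`-th largest element of a multiset of natural numbers, counted with multiplicity,
for `1 ≤ k ≤ s.card`: the entry number `k` of the decreasing rearrangement. -/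
def kthLargest (k : ℕ) (s : Multiset ℕ) : ℕ := (s.sort (· ≥ ·)).getD (k - 1) 0

/-- The `k`-th largest among `b_1 x, …, b_n x`, for `1 ≤ k ≤ n`. -/
def Mk (k n : ℕ) (x : ℝ) : ℕ :=
  kthLargest k ((Finset.Icc 1 n).val.map fun i => digit i x)

/-- The level `u_n(r) = n r / log G`. -/
def u (n : ℕ) (r : ℝ) : ℝ := n * r / Real.log Real.goldenRatio

end

end NICF

namespace NICF

open scoped ENNReal NNReal
open ProbabilityTheory

noncomputable section

/-! The number of exceedances is a sum of `n` rare, exponentially decorrelated indicators, so it is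
compared with a Poisson variable by replacing the summands one at a time.

Mixing comes from the transfer operator acting on positive functions whose logarithm is Lipschitz on
each half of `X`. Inverse branches contract by at least 4 and have bounded distortion, so a constant
`a` becomes `a / 4 + 1`, whatever weight is put on the first digit (`logLip_transfer`). In
particular `2` becomes `3 / 2`. This slack allows a fixed proportion of the mass to be subtracted as
a multiple of the invariant density while the rest stays in the class of constant `2`
(`exists_transfer_eq_add`). Iterating leaves mass `(1 - gap) ^ m` unmixed after `m` steps
(`LogLip.mixing`). Since digit weights are harmless, conditioning on the exceedance count up to time
`k` keeps the density of the orbit at time `k` in the class (`exists_logLip_density`), so the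
estimates are uniform in `k`.

Let `p` be the probability of one exceedance. Moving the count back `m` steps costs `O(m p²)`, and
the remaining dependence is `O((1 - gap) ^ m p)` (`abs_integral_decouple_le`). Hence the indicator
number `k + 1` can be replaced by an independent Poisson variable of mean `q = 1 / (n r)`, with
further errors `O(|p - q|)` and `O(q²)`. Poisson laws convolve, so `n` replacements give mean `1 /
r` (`abs_integral_sub_poissonStep_le`).

The tail asymptotics give `p = q + O(q²)`. The equation for `l` says `(3 / 4) ^ l = l / n`, so
taking `m` a fixed multiple of `⌈l⌉` balances the two dependence errors (`stepError_le`). The bound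
is uniform over sets of values of the count; order statistics are events of the form "count `< k`".
-/

/-! ### Digits and inverse branches. -/

theorem measurable_T : Measurable T := by
  unfold T
  refine Measurable.ite (measurableSet_singleton 0) measurable_const ?_
  have h : Measurable fun x : ℝ => Real.sign x / x := by
    refine Measurable.div ?_ measurable_id
    unfold Real.sign
    exact Measurable.ite measurableSet_Iio measurable_const
      (Measurable.ite measurableSet_Ioi measurable_const measurable_const)
  exact h.sub ((measurable_from_top (f := fun z : ℤ => (z : ℝ))).comp (h.add_const _).floor)

theorem measurable_firstDigit : Measurable firstDigit := by
  unfold firstDigit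
  exact Nat.measurable_floor.comp (by fun_prop)

theorem T_neg (x : ℝ) : T (-x) = T x := by
  simp [T, Real.sign_neg, neg_div_neg_eq]

theorem firstDigit_neg (x : ℝ) : firstDigit (-x) = firstDigit x := by
  simp [firstDigit]

theorem T_of_pos {x : ℝ} (hx : 0 < x) : T x = 1 / x - firstDigit x := by
  have h : 0 ≤ 1 / x + 1 / 2 := by positivity
  rw [T, if_neg hx.ne', Real.sign_of_pos hx, firstDigit, abs_of_pos (by positivity)]
  congr 1
  exact (natCast_floor_eq_intCast_floor h).symm

theorem T_mem_X (x : ℝ) : T x ∈ X := by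
  unfold T X
  split_ifs
  · constructor <;> norm_num
  · have h1 := Int.floor_le (Real.sign x / x + 1 / 2)
    have h2 := Int.lt_floor_add_one (Real.sign x / x + 1 / 2)
    constructor <;> linarith

theorem firstDigit_inv {b : ℕ} {t : ℝ} (ht : t ∈ X) (hb : 2 < (b : ℝ) + t) :
    firstDigit (1 / (b + t)) = b := by
  obtain ⟨h1, h2⟩ := ht
  rw [firstDigit, one_div_one_div, abs_of_pos (by linarith), Nat.floor_eq_iff (by linarith)]
  constructor <;> linarith

theorem T_inv {b : ℕ} {t : ℝ} (ht : t ∈ X) (hb : 2 < (b : ℝ) + t) :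
    T (1 / (b + t)) = t := by
  rw [T_of_pos (by positivity), firstDigit_inv ht hb, one_div_one_div]
  ring

/-- The points of `X` that the inverse branch `t ↦ 1 / (b + t)` sends into `(0, 1/2)`. -/
def branchDomain (b : ℕ) : Set ℝ := X ∩ {t | 2 < (b : ℝ) + t}

theorem measurableSet_X : MeasurableSet X := measurableSet_Ico

theorem measurableSet_branchDomain (b : ℕ) : MeasurableSet (branchDomain b) :=
  measurableSet_X.inter (measurableSet_lt measurable_const (by fun_prop))

theorem image_branchDomain (b : ℕ) :
    (fun t : ℝ => 1 / ((b : ℝ) + t)) '' branchDomain b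
      = Set.Ioo 0 (1 / 2) ∩ firstDigit ⁻¹' {b} := by
  ext x
  constructor
  · rintro ⟨t, ⟨ht, hb⟩, rfl⟩
    have hb' : 2 < (b : ℝ) + t := hb
    refine ⟨⟨by positivity, ?_⟩, firstDigit_inv ht hb⟩
    exact one_div_lt_one_div_of_lt (by norm_num) hb'
  · rintro ⟨⟨h0, h1⟩, hb⟩
    have hb' : firstDigit x = b := hb
    have hT := T_of_pos h0
    have e : (b : ℝ) + T x = 1 / x := by rw [hT, hb']; ring
    refine ⟨T x, ⟨T_mem_X x, ?_⟩, ?_⟩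
    · change 2 < (b : ℝ) + T x
      rw [e, lt_div_iff₀ h0]
      linarith
    · simp only [e, one_div_one_div]

/-! ### The weighted transfer operator and its duality. -/

/-- The transfer operator of `T` for Lebesgue measure, weighted by a function `φ` of the first
digit. -/
def transfer (φ : ℕ → ℝ≥0∞) (f : ℝ → ℝ≥0∞) (t : ℝ) : ℝ≥0∞ :=
  ∑' b : ℕ, if 2 < (b : ℝ) + t then
    φ b * ENNReal.ofReal (1 / (b + t) ^ 2) * (f (1 / (b + t)) + f (-(1 / (b + t)))) else 0

theorem measurable_transfer (φ : ℕ → ℝ≥0∞) {f : ℝ → ℝ≥0∞} (hf : Measurable f) :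
    Measurable (transfer φ f) := by
  refine Measurable.tsum fun b => Measurable.ite
    (measurableSet_lt measurable_const (by fun_prop)) ?_ measurable_const
  fun_prop

theorem lintegral_branch (b : ℕ) (g : ℝ → ℝ≥0∞) :
    ∫⁻ x in Set.Ioo 0 (1 / 2) ∩ firstDigit ⁻¹' {b}, g x
      = ∫⁻ t in branchDomain b, ENNReal.ofReal (1 / (b + t) ^ 2) * g (1 / (b + t)) := by
  have hd : ∀ t ∈ branchDomain b, HasDerivWithinAt (fun t : ℝ => 1 / ((b : ℝ) + t))
      (-1 / (b + t) ^ 2) (branchDomain b) t := by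
    intro t ht
    have h2 : 2 < (b : ℝ) + t := ht.2
    have := ((hasDerivAt_id t).const_add (b : ℝ)).inv (by simp; linarith)
    simp only [one_div]
    exact this.hasDerivWithinAt
  have hinj : Set.InjOn (fun t : ℝ => 1 / ((b : ℝ) + t)) (branchDomain b) := by
    intro s _ t _ h
    simpa using h
  rw [← image_branchDomain, lintegral_image_eq_lintegral_abs_deriv_mul
    (measurableSet_branchDomain b) hd hinj]
  refine lintegral_congr fun t => ?_
  rw [neg_div, abs_neg, abs_of_nonneg (by positivity)]

/-- Cut `(0, 1/2)` into digit cylinders and change variables by the inverse branch on each. The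
negative half reduces to this one because `T` and the first digit are even. -/
theorem lintegral_pos_half (φ : ℕ → ℝ≥0∞) {g ψ : ℝ → ℝ≥0∞} (hg : Measurable g)
    (hψ : Measurable ψ) :
    ∫⁻ x in Set.Ioo 0 (1 / 2), φ (firstDigit x) * g x * ψ (T x)
      = ∫⁻ t in X, (∑' b : ℕ, if 2 < (b : ℝ) + t then
        φ b * ENNReal.ofReal (1 / (b + t) ^ 2) * g (1 / (b + t)) else 0) * ψ t := by
  have hcover : Set.Ioo (0 : ℝ) (1 / 2) = ⋃ b, Set.Ioo 0 (1 / 2) ∩ firstDigit ⁻¹' {b} := by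
    ext x
    simp
  have hmeas : ∀ b, MeasurableSet (Set.Ioo (0 : ℝ) (1 / 2) ∩ firstDigit ⁻¹' {b}) := fun b =>
    measurableSet_Ioo.inter (measurable_firstDigit (measurableSet_singleton b))
  have hdisj : Pairwise (Function.onFun Disjoint
      fun b => Set.Ioo (0 : ℝ) (1 / 2) ∩ firstDigit ⁻¹' {b}) := by
    intro b c hbc
    rw [Function.onFun, Set.disjoint_left]
    rintro x ⟨_, hb⟩ ⟨_, hc⟩
    exact hbc (hb.symm.trans hc)
  rw [hcover, lintegral_iUnion hmeas hdisj]
  have hR : ∀ t, (∑' b : ℕ, if 2 < (b : ℝ) + t then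
        φ b * ENNReal.ofReal (1 / (b + t) ^ 2) * g (1 / (b + t)) else 0) * ψ t
      = ∑' b : ℕ, {t | 2 < (b : ℝ) + t}.indicator
        (fun t => φ b * ENNReal.ofReal (1 / (b + t) ^ 2) * g (1 / (b + t)) * ψ t) t := by
    intro t
    rw [← ENNReal.tsum_mul_right]
    refine tsum_congr fun b => ?_
    by_cases hb : 2 < (b : ℝ) + t <;> simp [hb]
  have hm : ∀ b : ℕ, MeasurableSet {t : ℝ | 2 < (b : ℝ) + t} := fun b =>
    measurableSet_lt measurable_const (by fun_prop)
  simp_rw [hR]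
  rw [lintegral_tsum fun b => (Measurable.indicator (by fun_prop) (hm b)).aemeasurable]
  refine tsum_congr fun b => ?_
  rw [lintegral_branch, lintegral_indicator (hm b), Measure.restrict_restrict (hm b),
    branchDomain, Set.inter_comm X]
  refine setLIntegral_congr_fun ((hm b).inter measurableSet_X) ?_
  rintro t ⟨h2, hX⟩
  simp only [firstDigit_inv hX h2, T_inv hX h2]
  ring

theorem lintegral_X_eq {F : ℝ → ℝ≥0∞} (hF : Measurable F) :
    ∫⁻ x in X, F x = ∫⁻ x in Set.Ioo 0 (1 / 2), (F x + F (-x)) := by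
  have h1 : ∫⁻ x in X, F x = (∫⁻ x in Set.Ico (-(1 / 2)) 0, F x) +
      ∫⁻ x in Set.Ico 0 (1 / 2), F x := by
    rw [← lintegral_union measurableSet_Ico, Set.Ico_union_Ico_eq_Ico (by norm_num) (by norm_num), X]
    exact Set.Ico_disjoint_Ico_same
  have h2 : ∫⁻ x in Set.Ioo 0 (1 / 2), F (-x) = ∫⁻ x in Set.Ioo (-(1 / 2)) 0, F x := by
    have := (Measure.measurePreserving_neg (volume : Measure ℝ)).setLIntegral_comp_preimage
      (s := Set.Ioo (-(1 / 2)) 0) measurableSet_Ioo hF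
    rw [← this]
    congr 2
    ext x
    simp
  rw [lintegral_add_left hF, h2, h1, add_comm]
  congr 1
  · exact setLIntegral_congr Ioo_ae_eq_Ico.symm
  · exact setLIntegral_congr Ioo_ae_eq_Ico.symm

/-- The transfer operator is dual to composition with `T`. -/
theorem lintegral_transfer_mul (φ : ℕ → ℝ≥0∞) {f ψ : ℝ → ℝ≥0∞} (hf : Measurable f)
    (hψ : Measurable ψ) :
    ∫⁻ t in X, transfer φ f t * ψ t = ∫⁻ x in X, φ (firstDigit x) * f x * ψ (T x) := by
  have hφ : Measurable fun x => φ (firstDigit x) := measurable_from_top.comp measurable_firstDigit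
  have hψT : Measurable fun x => ψ (T x) := hψ.comp measurable_T
  rw [lintegral_X_eq (F := fun x => φ (firstDigit x) * f x * ψ (T x))
    ((hφ.mul hf).mul hψT)]
  have := lintegral_pos_half φ (g := fun x => f x + f (-x)) (by fun_prop) hψ
  refine this.symm.trans ?_
  refine lintegral_congr fun x => ?_
  rw [firstDigit_neg, T_neg]
  ring

/-! ### Invariance and normalisation of the density. -/

/-- The density of `mu`, as an extended nonnegative function. -/
def dens (x : ℝ) : ℝ≥0∞ := ENNReal.ofReal (density x)

theorem measurable_density : Measurable density := by
  unfold density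
  exact Measurable.ite measurableSet_Ici (by fun_prop) (by fun_prop)

theorem measurable_dens : Measurable dens := measurable_density.ennreal_ofReal

theorem log_goldenRatio_pos : 0 < Real.log Real.goldenRatio :=
  Real.log_pos Real.one_lt_goldenRatio

theorem density_nonneg {x : ℝ} (hx : -(1 / 2) ≤ x) : 0 ≤ density x := by
  have h1 := Real.one_lt_goldenRatio
  have h2 := log_goldenRatio_pos
  unfold density
  split_ifs
  · positivity
  · have : 0 < Real.goldenRatio + 1 + x := by linarith
    positivity

/-- With `G² = G + 1`, the contributions of the preimages `1 / s` and `-1 / s` combine into a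
difference that telescopes under `s ↦ s + 1`. -/
theorem density_branch {s : ℝ} (hs : 2 < s) :
    1 / s ^ 2 * (density (1 / s) + density (-(1 / s)))
      = 1 / Real.log Real.goldenRatio *
        (1 / (s + Real.goldenRatio - 2) - 1 / (s + Real.goldenRatio - 1)) := by
  have h1 := Real.one_lt_goldenRatio
  have h2 := log_goldenRatio_pos
  have h3 := Real.goldenRatio_sq
  have hs0 : 0 < 1 / s := by positivity
  have h4 : 1 / s < 1 / 2 := one_div_lt_one_div_of_lt (by norm_num) hs
  unfold density
  rw [if_pos hs0.le, if_neg (by linarith)]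
  generalize Real.goldenRatio = G at *
  have e1 : 1 / (G + 1 / s) = s / (G * s + 1) := by field_simp
  have e2 : 1 / (G + 1 + -(1 / s)) = s / ((G + 1) * s - 1) := by
    have : (G + 1 + -(1 / s)) = ((G + 1) * s - 1) / s := by
      field_simp
      ring
    rw [this, one_div_div]
  have p1 : G * s + 1 ≠ 0 := by positivity
  have p2 : (G + 1) * s - 1 ≠ 0 := by nlinarith
  have p3 : s + G - 2 ≠ 0 := by linarith
  have p4 : s + G - 1 ≠ 0 := by linarith
  have q1 : G * s + 1 = G * (s + G - 1) := by linear_combination -h3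
  have q2 : (G + 1) * s - 1 = (G + 1) * (s + G - 2) := by linear_combination -h3
  rw [e1, e2, q1, q2]
  rw [← mul_add, mul_left_comm]
  congr 1
  have : G + 1 ≠ 0 := by linarith
  field_simp
  linear_combination (2 - s) * h3

theorem hasSum_telescope {V : ℕ → ℝ} (hV : Antitone V) (h0 : Filter.Tendsto V Filter.atTop (nhds 0)) :
    HasSum (fun n => V n - V (n + 1)) (V 0) := by
  rw [hasSum_iff_tendsto_nat_of_nonneg fun n => sub_nonneg.2 (hV n.le_succ)]
  simp_rw [Finset.sum_range_sub']
  simpa using h0.const_sub (V 0)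

/-- The sum over branches telescopes to its first term. The smallest admissible digit is 3 for `t <
0` and 2 for `t > 0`, which is the reason for the two formulas in the density. At `t = 0` the first
digit is 3 but the density takes the other formula, hence the exclusion. -/
theorem transfer_dens {t : ℝ} (ht : t ∈ X) (h0 : t ≠ 0) : transfer 1 dens t = dens t := by
  have hG1 := Real.one_lt_goldenRatio
  have hG2 := log_goldenRatio_pos
  obtain ⟨m, hm1, hm⟩ : ∃ m : ℕ, (∀ b : ℕ, 2 < (b : ℝ) + t ↔ m ≤ b) ∧
      density t = 1 / Real.log Real.goldenRatio * (1 / (m + t + Real.goldenRatio - 2)) := by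
    have ht1 := ht.1
    have ht2 := ht.2
    rcases lt_or_gt_of_ne h0 with h | h
    · refine ⟨3, fun b => ⟨fun hb => ?_, fun hb => ?_⟩, ?_⟩
      · have : (2 : ℝ) < b := by linarith
        exact_mod_cast this
      · have : (3 : ℝ) ≤ b := by exact_mod_cast hb
        linarith
      · rw [density, if_neg (by linarith)]
        push_cast
        ring_nf
    · refine ⟨2, fun b => ⟨fun hb => ?_, fun hb => ?_⟩, ?_⟩
      · have : (1 : ℝ) < b := by linarith
        exact_mod_cast this
      · have : (2 : ℝ) ≤ b := by exact_mod_cast hb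
        linarith
      · rw [density, if_pos h.le]
        push_cast
        ring_nf
  -- Freezing the index below `m` makes the differences for inadmissible digits vanish, so the
  -- telescoping can run over all of `ℕ`.
  set V : ℕ → ℝ := fun b => 1 / Real.log Real.goldenRatio *
    (1 / ((max b m : ℕ) + t + Real.goldenRatio - 2)) with hVdef
  have hm2 := (hm1 m).2 le_rfl
  have hpos : ∀ b : ℕ, 0 < ((max b m : ℕ) : ℝ) + t + Real.goldenRatio - 2 := by
    intro b
    have : (m : ℝ) ≤ (max b m : ℕ) := by exact_mod_cast le_max_right b m
    linarith
  have hV : Antitone V := by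
    intro b c hbc
    refine mul_le_mul_of_nonneg_left (one_div_le_one_div_of_le (hpos b) ?_) (by positivity)
    have : ((max b m : ℕ) : ℝ) ≤ (max c m : ℕ) := by exact_mod_cast max_le_max_right m hbc
    linarith
  have hlim : Filter.Tendsto V Filter.atTop (nhds 0) := by
    have : Filter.Tendsto (fun b : ℕ => ((max b m : ℕ) : ℝ) + t + Real.goldenRatio - 2)
        Filter.atTop Filter.atTop := by
      refine Filter.tendsto_atTop_mono (f := fun b : ℕ => (b : ℝ) + (t + Real.goldenRatio - 2))
        (fun b => ?_) (Filter.tendsto_atTop_add_const_right _ _ tendsto_natCast_atTop_atTop)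
      have : (b : ℝ) ≤ (max b m : ℕ) := by exact_mod_cast le_max_left b m
      linarith
    simpa [hVdef, one_div] using (this.inv_tendsto_atTop).const_mul (1 / Real.log Real.goldenRatio)
  have hterm : ∀ b : ℕ, (if 2 < (b : ℝ) + t then
      (1 : ℕ → ℝ≥0∞) b * ENNReal.ofReal (1 / (b + t) ^ 2) *
        (dens (1 / (b + t)) + dens (-(1 / (b + t)))) else 0) = ENNReal.ofReal (V b - V (b + 1)) := by
    intro b
    by_cases hb : 2 < (b : ℝ) + t
    · have hp : 0 < 1 / ((b : ℝ) + t) := by positivity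
      have hlt : 1 / ((b : ℝ) + t) < 1 / 2 := one_div_lt_one_div_of_lt (by norm_num) hb
      rw [if_pos hb, Pi.one_apply, one_mul, dens, dens, ← ENNReal.ofReal_add
        (density_nonneg (by linarith)) (density_nonneg (by linarith)),
        ← ENNReal.ofReal_mul (by positivity), density_branch hb]
      have hmb := (hm1 b).1 hb
      simp only [hVdef, max_eq_left hmb, max_eq_left (hmb.trans b.le_succ)]
      rw [← mul_sub]
      push_cast
      congr 4
      ring
    · have hmb : b + 1 ≤ m := by
        rw [hm1] at hb
        omega
      simp only [if_neg hb, hVdef, max_eq_right hmb, max_eq_right (b.le_succ.trans hmb), sub_self,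
        ENNReal.ofReal_zero]
  rw [transfer]
  simp_rw [hterm]
  have hs := hasSum_telescope hV hlim
  rw [← ENNReal.ofReal_tsum_of_nonneg (fun b => sub_nonneg.2 (hV b.le_succ)) hs.summable,
    hs.tsum_eq, dens, hm]
  simp [hVdef]

theorem ae_X_ne_zero : ∀ᵐ t ∂(volume.restrict X), t ∈ X ∧ t ≠ 0 := by
  filter_upwards [ae_restrict_mem measurableSet_X,
    ae_restrict_of_ae (Measure.ae_ne volume (0 : ℝ))] with t h1 h2 using ⟨h1, h2⟩

theorem lintegral_dens_comp_T {ψ : ℝ → ℝ≥0∞} (hψ : Measurable ψ) :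
    ∫⁻ x in X, dens x * ψ (T x) = ∫⁻ x in X, dens x * ψ x := by
  have := lintegral_transfer_mul 1 measurable_dens hψ
  simp only [Pi.one_apply, one_mul] at this
  rw [← this]
  refine lintegral_congr_ae ?_
  filter_upwards [ae_X_ne_zero] with t ht
  rw [transfer_dens ht.1 ht.2]

theorem lintegral_dens_comp_iterate (k : ℕ) {ψ : ℝ → ℝ≥0∞} (hψ : Measurable ψ) :
    ∫⁻ x in X, dens x * ψ (T^[k] x) = ∫⁻ x in X, dens x * ψ x := by
  induction k with
  | zero => rfl
  | succ k ih =>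
    rw [← ih]
    exact lintegral_dens_comp_T (hψ.comp (measurable_T.iterate k))

theorem lintegral_dens : ∫⁻ x in X, dens x = 1 := by
  have hG1 := Real.one_lt_goldenRatio
  have hG2 := log_goldenRatio_pos
  have hG3 := Real.goldenRatio_sq
  rw [lintegral_X_eq measurable_dens]
  have h1 : ∀ x ∈ Set.Ioo (0 : ℝ) (1 / 2), dens x + dens (-x) = ENNReal.ofReal
      (1 / Real.log Real.goldenRatio *
        (1 / (Real.goldenRatio + x) + 1 / (Real.goldenRatio + 1 - x))) := by
    intro x hx
    have hx1 := hx.1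
    have hx2 := hx.2
    rw [dens, dens, ← ENNReal.ofReal_add (density_nonneg (by linarith))
      (density_nonneg (by linarith)), density, density, if_pos hx.1.le, if_neg (by linarith)]
    ring_nf
  have hd : ∀ x ∈ Set.uIcc (0 : ℝ) (1 / 2), HasDerivAt
      (fun x => 1 / Real.log Real.goldenRatio *
        (Real.log (Real.goldenRatio + x) - Real.log (Real.goldenRatio + 1 - x)))
      (1 / Real.log Real.goldenRatio *
        (1 / (Real.goldenRatio + x) + 1 / (Real.goldenRatio + 1 - x))) x := by
    intro x hx
    rw [Set.uIcc_of_le (by norm_num)] at hx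
    have hx1 := hx.1
    have hx2 := hx.2
    refine HasDerivAt.const_mul _ ?_
    have e1 := ((hasDerivAt_id x).const_add Real.goldenRatio).log (by simp; linarith)
    have e2 := ((hasDerivAt_id x).const_sub (Real.goldenRatio + 1)).log (by simp; linarith)
    have := e1.sub e2
    rw [neg_div, sub_neg_eq_add] at this
    exact this
  have hc : ContinuousOn (fun x : ℝ => 1 / Real.log Real.goldenRatio *
        (1 / (Real.goldenRatio + x) + 1 / (Real.goldenRatio + 1 - x))) (Set.uIcc (0 : ℝ) (1 / 2)) := by
    rw [Set.uIcc_of_le (by norm_num)]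
    refine ContinuousOn.mul continuousOn_const (ContinuousOn.add ?_ ?_)
    · refine ContinuousOn.div continuousOn_const (by fun_prop) fun x hx => ?_
      have := hx.1
      linarith
    · refine ContinuousOn.div continuousOn_const (by fun_prop) fun x hx => ?_
      have := hx.2
      linarith
  have hi := intervalIntegral.integral_eq_sub_of_hasDerivAt hd hc.intervalIntegrable
  rw [setLIntegral_congr_fun measurableSet_Ioo h1, setLIntegral_congr Ioo_ae_eq_Ioc,
    ← ofReal_integral_eq_lintegral_ofReal, ← intervalIntegral.integral_of_le (by norm_num), hi]
  · have e : Real.goldenRatio + 1 - 1 / 2 = Real.goldenRatio + 1 / 2 := by ring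
    rw [e, add_zero, sub_zero, ← hG3, Real.log_pow, sub_self, ← mul_sub]
    rw [← ENNReal.ofReal_one]
    congr 1
    field_simp
    push_cast
    ring
  · exact (intervalIntegrable_iff_integrableOn_Ioc_of_le (by norm_num)).1 hc.intervalIntegrable
  · filter_upwards [ae_restrict_mem measurableSet_Ioc] with x hx
    have hx1 := hx.1
    have hx2 := hx.2
    have : 0 < Real.goldenRatio + 1 - x := by linarith
    change 0 ≤ _
    positivity

/-! ### Log-Lipschitz functions on the two halves. -/

/-- The points `s` and `t` lie in the same of the two intervals `(-1/2, 0)` and `(0, 1/2)`. -/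
def SameHalf (s t : ℝ) : Prop := 0 < s * t ∧ |s| < 1 / 2 ∧ |t| < 1 / 2

theorem SameHalf.symm {s t : ℝ} (h : SameHalf s t) : SameHalf t s :=
  ⟨by rw [mul_comm]; exact h.1, h.2.2, h.2.1⟩

/-- `log f` is Lipschitz with constant `a` on each of the intervals `(-1/2, 0)` and `(0, 1/2)`. -/
def LogLip (a : ℝ) (f : ℝ → ℝ≥0∞) : Prop :=
  ∀ s t, SameHalf s t → f s ≤ ENNReal.ofReal (Real.exp (a * |s - t|)) * f t

theorem LogLip.mono {a b : ℝ} (hab : a ≤ b) {f : ℝ → ℝ≥0∞} (hf : LogLip a f) : LogLip b f := by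
  intro s t h
  refine (hf s t h).trans ?_
  gcongr

theorem LogLip.add {a : ℝ} {f g : ℝ → ℝ≥0∞} (hf : LogLip a f) (hg : LogLip a g) :
    LogLip a fun x => f x + g x := by
  intro s t h
  rw [mul_add]
  exact add_le_add (hf s t h) (hg s t h)

theorem LogLip.const_mul {a : ℝ} {f : ℝ → ℝ≥0∞} (hf : LogLip a f) (c : ℝ≥0∞) :
    LogLip a fun x => c * f x := by
  intro s t h
  simp only
  rw [mul_left_comm]
  gcongr
  exact hf s t h

/-- The set of admissible branches is constant on each half, so transfer operators can be compared
branch by branch. -/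
theorem SameHalf.two_lt_add_iff {s t : ℝ} (h : SameHalf s t) (b : ℕ) :
    2 < (b : ℝ) + s ↔ 2 < (b : ℝ) + t := by
  have key : ∀ s t : ℝ, SameHalf s t → 2 < (b : ℝ) + s → 2 < (b : ℝ) + t := by
    rintro s t ⟨h1, h2, h3⟩ hb
    rw [abs_lt] at h2 h3
    rcases le_or_gt 3 b with hb3 | hb3
    · have : (3 : ℝ) ≤ b := by exact_mod_cast hb3
      linarith
    · have hb2 : (1 : ℝ) < b := by linarith
      have hb2' : 1 < b := by exact_mod_cast hb2
      have : b = 2 := by omega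
      subst this
      push_cast at hb ⊢
      have hs : 0 < s := by linarith
      have : 0 < t := pos_of_mul_pos_right h1 hs.le
      linarith
  exact ⟨key s t h, key t s h.symm⟩

/-- For `p, q > 2`, the map `p ↦ 1 / p` contracts by 4, which turns `a` into `a / 4`, and `log (1 /
p ^ 2)` is 1-Lipschitz, which adds `1`. The weight `φ` is constant on a branch and cancels. -/
theorem logLip_transfer {a : ℝ} (ha : 0 ≤ a) (φ : ℕ → ℝ≥0∞) {f : ℝ → ℝ≥0∞} (hf : LogLip a f) :
    LogLip (a / 4 + 1) (transfer φ f) := by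
  intro s t h
  rw [transfer, transfer, ← ENNReal.tsum_mul_left]
  refine ENNReal.tsum_le_tsum fun b => ?_
  by_cases hb : 2 < (b : ℝ) + s
  swap
  · rw [if_neg hb]
    exact bot_le
  have hbt := (h.two_lt_add_iff b).1 hb
  rw [if_pos hb, if_pos hbt]
  set p := (b : ℝ) + s with hp
  set q := (b : ℝ) + t with hq
  have hd : |s - t| = |p - q| := by congr 1; ring
  rw [hd]
  have hp1 : 0 < 1 / p := by positivity
  have hp2 : 1 / p < 1 / 2 := one_div_lt_one_div_of_lt (by norm_num) hb
  have hq1 : 0 < 1 / q := by positivity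
  have hq2 : 1 / q < 1 / 2 := one_div_lt_one_div_of_lt (by norm_num) hbt
  have hdist : |1 / p - 1 / q| ≤ |p - q| / 4 := by
    have : 1 / p - 1 / q = (q - p) / (p * q) := by field_simp
    rw [this, abs_div, abs_sub_comm q p, abs_of_pos (by positivity : 0 < p * q)]
    gcongr
    nlinarith
  have hw : 1 / p ^ 2 ≤ Real.exp |p - q| * (1 / q ^ 2) := by
    have h1 : q / p ≤ Real.exp (|p - q| / 2) := by
      have : q / p ≤ |p - q| / 2 + 1 := by
        rw [div_le_iff₀ (by linarith)]
        nlinarith [neg_abs_le (p - q), abs_nonneg (p - q)]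
      exact this.trans (Real.add_one_le_exp _)
    have h2 : (q / p) ^ 2 ≤ Real.exp |p - q| := by
      calc (q / p) ^ 2 ≤ (Real.exp (|p - q| / 2)) ^ 2 := by gcongr
        _ = Real.exp |p - q| := by rw [← Real.exp_nat_mul]; congr 1; push_cast; ring
    calc 1 / p ^ 2 = (q / p) ^ 2 * (1 / q ^ 2) := by field_simp
      _ ≤ _ := by gcongr
  have hf1 : f (1 / p) ≤ ENNReal.ofReal (Real.exp (a / 4 * |p - q|)) * f (1 / q) := by
    refine (hf (1 / p) (1 / q) ⟨by positivity, ?_, ?_⟩).trans ?_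
    · rwa [abs_of_pos hp1]
    · rwa [abs_of_pos hq1]
    · gcongr ENNReal.ofReal (Real.exp ?_) * _
      nlinarith
  have hf2 : f (-(1 / p)) ≤ ENNReal.ofReal (Real.exp (a / 4 * |p - q|)) * f (-(1 / q)) := by
    refine (hf (-(1 / p)) (-(1 / q)) ⟨?_, ?_, ?_⟩).trans ?_
    · rw [neg_mul_neg]; positivity
    · rwa [abs_neg, abs_of_pos hp1]
    · rwa [abs_neg, abs_of_pos hq1]
    · have e : |-(1 / p) - -(1 / q)| = |1 / p - 1 / q| := by
        rw [← abs_neg]; congr 1; ring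
      rw [e]
      gcongr ENNReal.ofReal (Real.exp ?_) * _
      nlinarith
  have hw' : ENNReal.ofReal (1 / p ^ 2)
      ≤ ENNReal.ofReal (Real.exp |p - q|) * ENNReal.ofReal (1 / q ^ 2) := by
    rw [← ENNReal.ofReal_mul (by positivity)]
    exact ENNReal.ofReal_le_ofReal hw
  have he : ENNReal.ofReal (Real.exp ((a / 4 + 1) * |p - q|))
      = ENNReal.ofReal (Real.exp |p - q|) * ENNReal.ofReal (Real.exp (a / 4 * |p - q|)) := by
    rw [← ENNReal.ofReal_mul (by positivity), ← Real.exp_add]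
    congr 2
    ring
  calc φ b * ENNReal.ofReal (1 / p ^ 2) * (f (1 / p) + f (-(1 / p)))
      ≤ φ b * (ENNReal.ofReal (Real.exp |p - q|) * ENNReal.ofReal (1 / q ^ 2)) *
        (ENNReal.ofReal (Real.exp (a / 4 * |p - q|)) * f (1 / q) +
          ENNReal.ofReal (Real.exp (a / 4 * |p - q|)) * f (-(1 / q))) := by gcongr
    _ = _ := by rw [he]; ring

theorem logLip_dens : LogLip 1 dens := by
  have hG1 := Real.one_lt_goldenRatio
  have hG2 := log_goldenRatio_pos
  rintro s t ⟨h1, h2, h3⟩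
  rw [abs_lt] at h2 h3
  rw [dens, dens, ← ENNReal.ofReal_mul (by positivity)]
  apply ENNReal.ofReal_le_ofReal
  have key : ∀ p q : ℝ, 1 ≤ p → 1 ≤ q → p - q = s - t →
      1 / Real.log Real.goldenRatio * (1 / p)
        ≤ Real.exp (1 * |s - t|) * (1 / Real.log Real.goldenRatio * (1 / q)) := by
    intro p q hp hq hpq
    rw [mul_left_comm, one_mul]
    refine mul_le_mul_of_nonneg_left ?_ (by positivity)
    have : q / p ≤ |s - t| + 1 := by
      rw [div_le_iff₀ (by linarith), ← hpq]
      nlinarith [neg_abs_le (p - q), abs_nonneg (p - q)]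
    have h' := this.trans (Real.add_one_le_exp _)
    calc 1 / p = (q / p) * (1 / q) := by field_simp
      _ ≤ _ := by gcongr
  rcases lt_trichotomy s 0 with hs | hs | hs
  · have ht : t < 0 := neg_of_mul_pos_right h1 hs.le
    rw [density, density, if_neg (by linarith), if_neg (by linarith)]
    exact key _ _ (by linarith) (by linarith) (by ring)
  · simp [hs] at h1
  · have ht : 0 < t := pos_of_mul_pos_right h1 hs.le
    rw [density, density, if_pos hs.le, if_pos ht.le]
    exact key _ _ (by linarith) (by linarith) (by ring)

theorem exp_one_le_three : Real.exp 1 ≤ 3 := Real.exp_one_lt_three.le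

/-- A half has length `1 / 2`, so the oscillation factor is at most `exp (2 / 2) ≤ 3`. -/
theorem LogLip.le_three_mul {f : ℝ → ℝ≥0∞} (hf : LogLip 2 f) {s t : ℝ} (h : SameHalf s t) :
    f s ≤ 3 * f t := by
  refine (hf s t h).trans ?_
  gcongr
  rw [← ENNReal.ofReal_ofNat]
  apply ENNReal.ofReal_le_ofReal
  refine le_trans (Real.exp_le_exp.2 ?_) exp_one_le_three
  have hst := h.1
  have h2 := abs_lt.1 h.2.1
  have h3 := abs_lt.1 h.2.2
  have : |s - t| ≤ 1 / 2 := by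
    rw [abs_le]
    rcases lt_trichotomy s 0 with hs | hs | hs
    · have ht : t < 0 := neg_of_mul_pos_right hst hs.le
      constructor <;> linarith
    · simp [hs] at hst
    · have ht : 0 < t := pos_of_mul_pos_right hst hs.le
      constructor <;> linarith
  linarith

theorem volume_half_of {H : Set ℝ} {a : ℝ} (hH : H = Set.Ioo a (a + 1 / 2)) :
    volume H = (2 : ℝ≥0∞)⁻¹ := by
  rw [hH, Real.volume_Ioo, add_sub_cancel_left, one_div, ENNReal.ofReal_inv_of_pos (by norm_num)]
  simp

theorem LogLip.le_mul_setLIntegral {f : ℝ → ℝ≥0∞} (hf : LogLip 2 f) {a : ℝ}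
    (hH : ∀ s ∈ Set.Ioo a (a + 1 / 2), ∀ t ∈ Set.Ioo a (a + 1 / 2), SameHalf s t)
    {t : ℝ} (ht : t ∈ Set.Ioo a (a + 1 / 2)) :
    f t ≤ 6 * ∫⁻ s in Set.Ioo a (a + 1 / 2), f s := by
  have h1 : ∫⁻ _ in Set.Ioo a (a + 1 / 2), f t ≤ ∫⁻ s in Set.Ioo a (a + 1 / 2), 3 * f s :=
    setLIntegral_mono' measurableSet_Ioo fun s hs => hf.le_three_mul (hH t ht s hs)
  rw [setLIntegral_const, volume_half_of rfl, lintegral_const_mul' _ _ (by simp)] at h1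
  calc f t = 2 * (f t * 2⁻¹) := by
        rw [mul_comm (f t), ← mul_assoc, ENNReal.mul_inv_cancel (by simp) (by simp), one_mul]
    _ ≤ 2 * (3 * ∫⁻ s in Set.Ioo a (a + 1 / 2), f s) := by gcongr
    _ = _ := by rw [← mul_assoc]; norm_num

theorem LogLip.setLIntegral_le_mul {f : ℝ → ℝ≥0∞} (hf : LogLip 2 f) {a : ℝ}
    (hH : ∀ s ∈ Set.Ioo a (a + 1 / 2), ∀ t ∈ Set.Ioo a (a + 1 / 2), SameHalf s t)
    {t : ℝ} (ht : t ∈ Set.Ioo a (a + 1 / 2)) :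
    ∫⁻ s in Set.Ioo a (a + 1 / 2), f s ≤ 2 * f t := by
  have h1 : ∫⁻ s in Set.Ioo a (a + 1 / 2), f s ≤ ∫⁻ _ in Set.Ioo a (a + 1 / 2), 3 * f t :=
    setLIntegral_mono' measurableSet_Ioo fun s hs => hf.le_three_mul (hH s hs t ht)
  rw [setLIntegral_const, volume_half_of rfl] at h1
  refine h1.trans ?_
  rw [mul_right_comm]
  gcongr
  rw [← div_eq_mul_inv]
  refine ENNReal.div_le_of_le_mul ?_
  norm_num

theorem sameHalf_pos : ∀ s ∈ Set.Ioo (0 : ℝ) (0 + 1 / 2), ∀ t ∈ Set.Ioo (0 : ℝ) (0 + 1 / 2),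
    SameHalf s t := by
  rintro s ⟨h1, h2⟩ t ⟨h3, h4⟩
  rw [zero_add] at h2 h4
  exact ⟨mul_pos h1 h3, by rwa [abs_of_pos h1], by rwa [abs_of_pos h3]⟩

theorem sameHalf_neg : ∀ s ∈ Set.Ioo (-(1 / 2) : ℝ) (-(1 / 2) + 1 / 2),
    ∀ t ∈ Set.Ioo (-(1 / 2) : ℝ) (-(1 / 2) + 1 / 2), SameHalf s t := by
  rintro s ⟨h1, h2⟩ t ⟨h3, h4⟩
  rw [neg_add_cancel] at h2 h4
  exact ⟨mul_pos_of_neg_of_neg h2 h4, by rw [abs_of_neg h2]; linarith,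
    by rw [abs_of_neg h4]; linarith⟩

theorem lintegral_X_eq_add (f : ℝ → ℝ≥0∞) :
    ∫⁻ s in X, f s = (∫⁻ s in Set.Ioo (-(1 / 2) : ℝ) (-(1 / 2) + 1 / 2), f s) +
      ∫⁻ s in Set.Ioo (0 : ℝ) (0 + 1 / 2), f s := by
  rw [neg_add_cancel, zero_add, setLIntegral_congr Ioo_ae_eq_Ico, setLIntegral_congr Ioo_ae_eq_Ico,
    ← lintegral_union measurableSet_Ico Set.Ico_disjoint_Ico_same,
    Set.Ico_union_Ico_eq_Ico (by norm_num) (by norm_num), X]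

theorem LogLip.le_lintegral {f : ℝ → ℝ≥0∞} (hf : LogLip 2 f) {t : ℝ} (ht : SameHalf t t) :
    f t ≤ 6 * ∫⁻ s in X, f s := by
  rw [lintegral_X_eq_add]
  obtain ⟨h1, h2, -⟩ := ht
  rw [abs_lt] at h2
  rcases lt_or_gt_of_ne (show t ≠ 0 by rintro rfl; simp at h1) with h | h
  · refine (hf.le_mul_setLIntegral sameHalf_neg (t := t) ⟨h2.1, by linarith⟩).trans ?_
    gcongr
    exact le_self_add
  · refine (hf.le_mul_setLIntegral sameHalf_pos (t := t) ⟨h, by linarith⟩).trans ?_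
    gcongr
    exact le_add_self

theorem ae_sameHalf : ∀ᵐ t ∂(volume.restrict X), SameHalf t t := by
  filter_upwards [ae_X_ne_zero, ae_restrict_of_ae (Measure.ae_ne volume (-(1 / 2) : ℝ))]
    with t h1 h2
  have h3 : |t| < 1 / 2 := abs_lt.2 ⟨lt_of_le_of_ne h1.1.1 h2.symm, h1.1.2⟩
  exact ⟨mul_self_pos.2 h1.2, h3, h3⟩

theorem LogLip.lintegral_le_transfer {f : ℝ → ℝ≥0∞} (hf : LogLip 2 f) {t : ℝ}
    (ht : SameHalf t t) :
    ENNReal.ofReal (1 / 25) * ∫⁻ s in X, f s ≤ transfer 1 f t := by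
  have h2 := abs_lt.1 ht.2.1
  -- The branch with digit 3 is admissible from both halves, and its two preimages see both halves.
  -- It alone gives the lower bound, as its weight is at least `1 / 3.5 ^ 2 ≥ 2 / 25`.
  have h3 : 2 < ((3 : ℕ) : ℝ) + t := by push_cast; linarith
  refine le_trans ?_ (ENNReal.le_tsum 3)
  rw [if_pos h3, Pi.one_apply, one_mul]
  set q := ((3 : ℕ) : ℝ) + t with hq
  have hq3 : q < 3.5 := by rw [hq]; push_cast; linarith
  have hp : 0 < 1 / q := by positivity
  have hlt : 1 / q < 1 / 2 := one_div_lt_one_div_of_lt (by norm_num) h3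
  have e1 := hf.setLIntegral_le_mul sameHalf_pos (t := 1 / q) ⟨hp, by linarith⟩
  have e2 := hf.setLIntegral_le_mul sameHalf_neg (t := -(1 / q)) ⟨by linarith, by linarith⟩
  have hw : 2 * (1 / 25 : ℝ) ≤ 1 / q ^ 2 := by
    rw [le_div_iff₀ (by positivity)]
    nlinarith
  rw [lintegral_X_eq_add]
  calc _ ≤ ENNReal.ofReal (1 / 25) * (2 * f (-(1 / q)) + 2 * f (1 / q)) := by gcongr
    _ = ENNReal.ofReal (2 * (1 / 25)) * (f (1 / q) + f (-(1 / q))) := by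
        rw [ENNReal.ofReal_mul (by norm_num), ENNReal.ofReal_ofNat]; ring
    _ ≤ _ := by gcongr

/-! ### Spectral gap and exponential mixing. -/

/-- The spectral gap obtained for the transfer operator. -/
def gap : ℝ := Real.log Real.goldenRatio / 150

theorem gap_pos : 0 < gap := div_pos log_goldenRatio_pos (by norm_num)

theorem log_goldenRatio_lt_one : Real.log Real.goldenRatio < 1 := by
  have h1 := Real.log_le_sub_one_of_pos Real.goldenRatio_pos
  linarith [Real.goldenRatio_lt_two]

theorem gap_lt_one : gap < 1 := by
  have := log_goldenRatio_lt_one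
  unfold gap
  linarith

theorem density_le (x : ℝ) (hx : -(1 / 2) ≤ x) : density x ≤ 1 / Real.log Real.goldenRatio := by
  have hG1 := Real.one_lt_goldenRatio
  have hG2 := log_goldenRatio_pos
  unfold density
  split_ifs with h
  · refine mul_le_of_le_one_right (by positivity) ?_
    rw [div_le_one (by linarith)]
    linarith
  · refine mul_le_of_le_one_right (by positivity) ?_
    rw [div_le_one (by linarith)]
    linarith

theorem le_density (x : ℝ) (hx : x ∈ X) :
    1 / (3 * Real.log Real.goldenRatio) ≤ density x := by
  have hG1 := Real.one_lt_goldenRatio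
  have hG3 := Real.goldenRatio_lt_two
  have hG2 := log_goldenRatio_pos
  have hx1 := hx.1
  have hx2 := hx.2
  have key : ∀ p : ℝ, 0 < p → p ≤ 3 → 1 / (3 * Real.log Real.goldenRatio) ≤
      1 / Real.log Real.goldenRatio * (1 / p) := by
    intro p hp0 hp
    rw [← one_div_mul_one_div, mul_comm]
    refine mul_le_mul_of_nonneg_left ?_ (by positivity)
    exact one_div_le_one_div_of_le hp0 hp
  unfold density
  split_ifs with h
  · exact key _ (by linarith) (by linarith)
  · exact key _ (by linarith) (by linarith)

/-- With `y = exp (d / 2)` this becomes `(y ^ 4 - y ^ (-2)) B ≤ (y ^ 4 - y ^ 3) A`, and the factor 6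
comes from `y ^ 6 - 1 ≤ 6 y ^ 5 (y - 1)`. -/
theorem exp_sub_mul_le {A B d : ℝ} (hB : 0 ≤ B) (hAB : 6 * B ≤ A) (hd : 0 ≤ d) :
    Real.exp (3 / 2 * d) * A ≤ Real.exp (2 * d) * (A - B) + Real.exp (-d) * B := by
  set y := Real.exp (d / 2) with hy
  have hy1 : 1 ≤ y := Real.one_le_exp (by linarith)
  have e1 : Real.exp (3 / 2 * d) = y ^ 3 := by
    rw [hy, ← Real.exp_nat_mul]; congr 1; push_cast; ring
  have e2 : Real.exp (2 * d) = y ^ 4 := by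
    rw [hy, ← Real.exp_nat_mul]; congr 1; push_cast; ring
  have e3 : Real.exp (-d) = (y ^ 2)⁻¹ := by
    rw [hy, ← Real.exp_nat_mul, ← Real.exp_neg]; congr 1; push_cast; ring
  rw [e1, e2, e3]
  have h6 : y ^ 6 - 1 ≤ 6 * y ^ 5 * (y - 1) := by
    have : 6 * y ^ 5 * (y - 1) - (y ^ 6 - 1)
        = (y - 1) * ((y ^ 5 - 1) + (y ^ 5 - y) + (y ^ 5 - y ^ 2) + (y ^ 5 - y ^ 3)
          + (y ^ 5 - y ^ 4)) := by ring
    have hp : ∀ k ≤ 5, y ^ k ≤ y ^ 5 := fun k hk => pow_le_pow_right₀ hy1 hk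
    have := hp 0 (by norm_num)
    have := hp 1 (by norm_num)
    have := hp 2 (by norm_num)
    have := hp 3 (by norm_num)
    have := hp 4 (by norm_num)
    simp only [pow_zero, pow_one] at *
    have : 0 ≤ (y - 1) * ((y ^ 5 - 1) + (y ^ 5 - y) + (y ^ 5 - y ^ 2) + (y ^ 5 - y ^ 3)
          + (y ^ 5 - y ^ 4)) := mul_nonneg (by linarith) (by linarith)
    linarith
  have hy0 : 0 < y := by linarith
  have h7 : y ^ 4 - (y ^ 2)⁻¹ ≤ 6 * (y ^ 3 * (y - 1)) := by
    have : y ^ 4 - (y ^ 2)⁻¹ = (y ^ 6 - 1) / y ^ 2 := by field_simp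
    rw [this, div_le_iff₀ (by positivity)]
    linarith
  have h8 : (y ^ 4 - (y ^ 2)⁻¹) * B ≤ 6 * (y ^ 3 * (y - 1)) * B := by gcongr
  have h9 : y ^ 3 * (y - 1) * (6 * B) ≤ y ^ 3 * (y - 1) * A := by
    have : 0 ≤ y - 1 := by linarith
    gcongr
  nlinarith

/-- Subtracting a small enough part worsens the constant only from `3 / 2` to `2`, the constant from
which the transfer operator produced `3 / 2`. -/
theorem logLip_sub {F D : ℝ → ℝ≥0∞} (hF : LogLip (3 / 2) F) (hD : LogLip 1 D)
    (hfin : ∀ t, SameHalf t t → F t ≠ ∞) (hle : ∀ t, SameHalf t t → 6 * D t ≤ F t) :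
    LogLip 2 fun t => F t - D t := by
  intro s t h
  have htt : SameHalf t t := by
    refine ⟨mul_self_pos.2 ?_, h.2.2, h.2.2⟩
    rintro rfl
    simpa using h.1
  have hDF : D t ≤ 6 * D t := le_mul_of_one_le_left bot_le (by norm_num)
  have hDfin : D t ≠ ∞ := ((hDF.trans (hle t htt)).trans_lt (hfin t htt).lt_top).ne
  have hFs := hF s t h
  have hDt := hD t s h.symm
  have h6 := hle t htt
  obtain ⟨A, hA0, hA⟩ : ∃ A : ℝ, 0 ≤ A ∧ F t = ENNReal.ofReal A :=
    ⟨_, ENNReal.toReal_nonneg, (ENNReal.ofReal_toReal (hfin t htt)).symm⟩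
  obtain ⟨B, hB0, hB⟩ : ∃ B : ℝ, 0 ≤ B ∧ D t = ENNReal.ofReal B :=
    ⟨_, ENNReal.toReal_nonneg, (ENNReal.ofReal_toReal hDfin).symm⟩
  simp only
  rw [hA] at hFs h6 ⊢
  rw [hB] at hDt h6 ⊢
  rw [← ENNReal.ofReal_ofNat, ← ENNReal.ofReal_mul (by norm_num),
    ENNReal.ofReal_le_ofReal_iff hA0] at h6
  have hDs : ENNReal.ofReal (Real.exp (-|s - t|)) * ENNReal.ofReal B ≤ D s := by
    calc _ ≤ ENNReal.ofReal (Real.exp (-|s - t|)) *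
          (ENNReal.ofReal (Real.exp (1 * |t - s|)) * D s) := by gcongr
      _ = D s := by
        rw [← mul_assoc, ← ENNReal.ofReal_mul (by positivity), ← Real.exp_add, abs_sub_comm]
        simp
  rw [tsub_le_iff_right]
  refine hFs.trans ((le_trans ?_ (add_le_add_right hDs _)))
  rw [← ENNReal.ofReal_sub _ hB0, ← ENNReal.ofReal_mul (by positivity),
    ← ENNReal.ofReal_mul (by positivity), ← ENNReal.ofReal_mul (by positivity),
    ← ENNReal.ofReal_add (mul_nonneg (by positivity) (by linarith)) (by positivity)]
  exact ENNReal.ofReal_le_ofReal (exp_sub_mul_le hB0 h6 (abs_nonneg _))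

/-- One application of the transfer operator splits off a multiple of the invariant density, and
leaves a function that is as regular as the one started from. -/
theorem exists_transfer_eq_add {f : ℝ → ℝ≥0∞} (hfm : Measurable f) (hf : LogLip 2 f)
    (hfin : ∫⁻ x in X, f x ≠ ∞) :
    ∃ g : ℝ → ℝ≥0∞, Measurable g ∧ LogLip 2 g ∧
      ∫⁻ x in X, g x = ENNReal.ofReal (1 - gap) * ∫⁻ x in X, f x ∧
      ∀ t, SameHalf t t →
        transfer 1 f t = ENNReal.ofReal gap * (∫⁻ x in X, f x) * dens t + g t := by
  set c := ∫⁻ x in X, f x with hc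
  have hL : LogLip (3 / 2) (transfer 1 f) := by
    convert logLip_transfer (by norm_num) 1 hf using 1
    norm_num
  have hint : ∫⁻ x in X, transfer 1 f x = c := by
    simpa using lintegral_transfer_mul 1 hfm (ψ := fun _ => 1) measurable_const
  have hLfin : ∀ t, SameHalf t t → transfer 1 f t ≠ ∞ := by
    intro t ht
    have := (hL.mono (by norm_num : (3 / 2 : ℝ) ≤ 2)).le_lintegral ht
    rw [hint] at this
    exact (this.trans_lt (ENNReal.mul_lt_top (by simp) hfin.lt_top)).ne
  -- The value of `gap` is chosen here: the density is at most `1 / log G`, and `6 * gap / log G = 1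
  -- / 25`.
  have h6 : ∀ t, SameHalf t t → 6 * (ENNReal.ofReal gap * c * dens t) ≤ transfer 1 f t := by
    intro t ht
    refine le_trans ?_ (hf.lintegral_le_transfer ht)
    have : dens t ≤ ENNReal.ofReal (1 / Real.log Real.goldenRatio) :=
      ENNReal.ofReal_le_ofReal (density_le t (abs_lt.1 ht.2.1).1.le)
    calc 6 * (ENNReal.ofReal gap * c * dens t)
        ≤ 6 * (ENNReal.ofReal gap * c * ENNReal.ofReal (1 / Real.log Real.goldenRatio)) := by
          gcongr
      _ = ENNReal.ofReal (6 * (gap * (1 / Real.log Real.goldenRatio))) * c := by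
          rw [ENNReal.ofReal_mul (by norm_num), ENNReal.ofReal_mul gap_pos.le,
            ENNReal.ofReal_ofNat]
          ring
      _ = _ := by
          have := log_goldenRatio_pos
          congr 2
          unfold gap
          field_simp
          norm_num
  have hle : ∀ t, SameHalf t t → ENNReal.ofReal gap * c * dens t ≤ transfer 1 f t := fun t ht =>
    (le_mul_of_one_le_left bot_le (by norm_num)).trans (h6 t ht)
  have heq : ∀ t, SameHalf t t → transfer 1 f t = ENNReal.ofReal gap * c * dens t +
      (transfer 1 f t - ENNReal.ofReal gap * c * dens t) := fun t ht =>
    (add_tsub_cancel_of_le (hle t ht)).symm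
  have hmd : Measurable fun t => ENNReal.ofReal gap * c * dens t :=
    measurable_dens.const_mul _
  refine ⟨fun t => transfer 1 f t - ENNReal.ofReal gap * c * dens t,
    (measurable_transfer 1 hfm).sub hmd, logLip_sub hL (logLip_dens.const_mul _) hLfin h6, ?_, heq⟩
  have hsum : c = ENNReal.ofReal gap * c +
      ∫⁻ t in X, (transfer 1 f t - ENNReal.ofReal gap * c * dens t) := by
    conv_lhs => rw [← hint]
    rw [lintegral_congr_ae (ae_sameHalf.mono heq), lintegral_add_left hmd,
      lintegral_const_mul _ measurable_dens, lintegral_dens, mul_one]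
  have hgfin : ENNReal.ofReal gap * c ≠ ∞ := ENNReal.mul_ne_top (by simp) hfin
  have hsplit : c = ENNReal.ofReal gap * c + ENNReal.ofReal (1 - gap) * c := by
    rw [← add_mul, ← ENNReal.ofReal_add gap_pos.le (by linarith [gap_lt_one])]
    simp
  exact (ENNReal.add_right_inj hgfin).1 (hsum.symm.trans hsplit)

/-- Almost everywhere `f ≤ 6 ∫ f` and `1 ≤ 3 * dens`. This is the crude bound for the part of the
mass not yet mixed. -/
theorem LogLip.lintegral_mul_le {f ψ : ℝ → ℝ≥0∞} (hf : LogLip 2 f) (hψ : Measurable ψ) :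
    ∫⁻ x in X, f x * ψ x ≤ 18 * (∫⁻ x in X, f x) * ∫⁻ x in X, dens x * ψ x := by
  have hG2 := log_goldenRatio_pos
  have hG3 := log_goldenRatio_lt_one
  rw [← lintegral_const_mul _ (show Measurable fun x => dens x * ψ x from measurable_dens.mul hψ)]
  refine lintegral_mono_ae ?_
  filter_upwards [ae_sameHalf, ae_X_ne_zero] with t ht hX
  have h1 := hf.le_lintegral ht
  have h3 : 1 ≤ 3 * dens t := by
    have : (1 : ℝ≥0∞) = 3 * ENNReal.ofReal (1 / 3) := by
      rw [← ENNReal.ofReal_ofNat, ← ENNReal.ofReal_mul (by norm_num)]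
      norm_num
    rw [this]
    gcongr
    refine ENNReal.ofReal_le_ofReal (le_trans ?_ (le_density t hX.1))
    exact one_div_le_one_div_of_le (by positivity) (by linarith)
  calc f t * ψ t ≤ 6 * (∫⁻ s in X, f s) * ψ t * 1 := by rw [mul_one]; gcongr
    _ ≤ 6 * (∫⁻ s in X, f s) * ψ t * (3 * dens t) := by gcongr
    _ = 6 * 3 * (∫⁻ s in X, f s) * (dens t * ψ t) := by ring
    _ = _ := by norm_num

theorem lintegral_mul_comp_T {f ψ : ℝ → ℝ≥0∞} (hf : Measurable f) (hψ : Measurable ψ) :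
    ∫⁻ x in X, f x * ψ (T x) = ∫⁻ x in X, transfer 1 f x * ψ x := by
  simpa using (lintegral_transfer_mul 1 hf hψ).symm

/-- Exponential mixing for functions with a log-Lipschitz density. -/
theorem LogLip.mixing (m : ℕ) : ∀ {f ψ : ℝ → ℝ≥0∞}, Measurable f → LogLip 2 f →
    ∫⁻ x in X, f x ≠ ∞ → Measurable ψ →
    ENNReal.ofReal (1 - (1 - gap) ^ m) * (∫⁻ x in X, f x) * (∫⁻ x in X, dens x * ψ x)
        ≤ ∫⁻ x in X, f x * ψ (T^[m] x) ∧
      ∫⁻ x in X, f x * ψ (T^[m] x)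
        ≤ ENNReal.ofReal (1 - (1 - gap) ^ m) * (∫⁻ x in X, f x) * (∫⁻ x in X, dens x * ψ x) +
          ENNReal.ofReal ((1 - gap) ^ m) *
            (18 * (∫⁻ x in X, f x) * (∫⁻ x in X, dens x * ψ x)) := by
  have hg0 := gap_pos
  have hg1 := gap_lt_one
  induction m with
  | zero =>
    intro f ψ _ hf _ hψ
    simpa using hf.lintegral_mul_le hψ
  | succ m ih =>
    intro f ψ hfm hf hfin hψ
    obtain ⟨g, hgm, hg, hgi, heq⟩ := exists_transfer_eq_add hfm hf hfin
    have hψT : Measurable fun x => ψ (T^[m] x) := hψ.comp (measurable_T.iterate m)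
    set c := ∫⁻ x in X, f x
    set w := ∫⁻ x in X, dens x * ψ x
    have hgfin : ∫⁻ x in X, g x ≠ ∞ := by
      rw [hgi]
      exact ENNReal.mul_ne_top (by simp) hfin
    have e : ∫⁻ x in X, f x * ψ (T^[m + 1] x)
        = ENNReal.ofReal gap * c * w + ∫⁻ x in X, g x * ψ (T^[m] x) := by
      have := lintegral_mul_comp_T hfm hψT
      have hdψ : Measurable fun x => dens x * ψ (T^[m] x) := measurable_dens.mul hψT
      have hw : w = ∫⁻ x in X, dens x * ψ (T^[m] x) := (lintegral_dens_comp_iterate m hψ).symm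
      simp only [Function.iterate_succ, Function.comp_apply]
      rw [this, hw, ← lintegral_const_mul _ hdψ, ← lintegral_add_left (hdψ.const_mul _)]
      refine lintegral_congr_ae (ae_sameHalf.mono fun t ht => ?_)
      simp only
      rw [heq t ht, add_mul, mul_assoc _ (dens t)]
    obtain ⟨h1, h2⟩ := ih hgm hg hgfin hψ
    rw [hgi] at h1 h2
    have hpow : (1 - gap) ^ m ≤ 1 := pow_le_one₀ (by linarith) (by linarith)
    have es : ENNReal.ofReal (1 - (1 - gap) ^ (m + 1)) * c * w = ENNReal.ofReal gap * c * w +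
        ENNReal.ofReal (1 - (1 - gap) ^ m) * (ENNReal.ofReal (1 - gap) * c) * w := by
      have : 1 - (1 - gap) ^ (m + 1) = gap + (1 - (1 - gap) ^ m) * (1 - gap) := by ring
      rw [this, ENNReal.ofReal_add hg0.le (mul_nonneg (by linarith) (by linarith)),
        ENNReal.ofReal_mul (by linarith)]
      ring
    have ep : ENNReal.ofReal ((1 - gap) ^ (m + 1)) * (18 * c * w) =
        ENNReal.ofReal ((1 - gap) ^ m) * (18 * (ENNReal.ofReal (1 - gap) * c) * w) := by
      rw [pow_succ, ENNReal.ofReal_mul (pow_nonneg (by linarith) m)]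
      ring
    rw [e, es, ep, add_assoc]
    exact ⟨by gcongr, by gcongr⟩

/-! ### Exceedance counts and conditional densities. -/

theorem S_zero (x v : ℝ) : S 0 x v = 0 := by simp [S]

theorem S_succ (k : ℕ) (x v : ℝ) :
    S (k + 1) x v = S k x v + if v < (firstDigit (T^[k] x) : ℝ) then 1 else 0 := by
  have hd : digit (k + 1) x = firstDigit (T^[k] x) := rfl
  rw [S, S, ← Finset.insert_Icc_right_eq_Icc_add_one (by omega), Finset.filter_insert, hd]
  split_ifs with h
  · rw [Finset.card_insert_of_notMem (by simp)]
  · rfl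

theorem measurable_S (k : ℕ) (v : ℝ) : Measurable fun x => S k x v := by
  induction k with
  | zero => simp only [S_zero, measurable_const]
  | succ k ih =>
    simp only [S_succ]
    refine ih.add (Measurable.ite ?_ measurable_const measurable_const)
    exact measurableSet_lt measurable_const (measurable_from_top.comp
      (measurable_firstDigit.comp (measurable_T.iterate k)))

/-- Functions of the number of exceedances among the first `k` digits have a log-Lipschitz
conditional density given the orbit after time `k`. -/
theorem exists_logLip_density (v : ℝ) (k : ℕ) : ∀ g : ℕ → ℝ≥0∞,
    ∃ F : ℝ → ℝ≥0∞, Measurable F ∧ LogLip 2 F ∧ ∀ ψ : ℝ → ℝ≥0∞, Measurable ψ →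
      ∫⁻ x in X, dens x * (g (S k x v) * ψ (T^[k] x)) = ∫⁻ x in X, F x * ψ x := by
  induction k with
  | zero =>
    intro g
    refine ⟨fun x => g 0 * dens x, measurable_dens.const_mul _,
      (logLip_dens.mono (by norm_num)).const_mul _, fun ψ _ => lintegral_congr fun x => ?_⟩
    simp only [S_zero, Function.iterate_zero, id]
    ring
  | succ k ih =>
    intro g
    obtain ⟨F, hFm, hF, hFi⟩ := ih g
    obtain ⟨F', hFm', hF', hFi'⟩ := ih fun s => g (s + 1)
    -- The next digit either leaves the count alone (weight `φ`, function `g`) or raises it by one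
    -- (weight `φ'`, shifted `g`). Each case is one weighted transfer of a density supplied by
    -- induction.
    set φ : ℕ → ℝ≥0∞ := fun b => if v < (b : ℝ) then 0 else 1 with hφ
    set φ' : ℕ → ℝ≥0∞ := fun b => if v < (b : ℝ) then 1 else 0 with hφ'
    have hm : ∀ φ : ℕ → ℝ≥0∞, Measurable fun x => φ (firstDigit x) := fun φ =>
      measurable_from_top.comp measurable_firstDigit
    refine ⟨fun x => transfer φ F x + transfer φ' F' x,
      (measurable_transfer φ hFm).add (measurable_transfer φ' hFm'),
      ((logLip_transfer (by norm_num) φ hF).mono (by norm_num)).add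
        ((logLip_transfer (by norm_num) φ' hF').mono (by norm_num)), fun ψ hψ => ?_⟩
    have hψT : Measurable fun x => ψ (T x) := hψ.comp measurable_T
    simp_rw [add_mul]
    have hmψ : Measurable fun x => transfer φ F x * ψ x := (measurable_transfer φ hFm).mul hψ
    rw [lintegral_add_left hmψ, lintegral_transfer_mul φ hFm hψ,
      lintegral_transfer_mul φ' hFm' hψ]
    have a1 := hFi (fun x => φ (firstDigit x) * ψ (T x)) ((hm φ).mul hψT)
    have a2 := hFi' (fun x => φ' (firstDigit x) * ψ (T x)) ((hm φ').mul hψT)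
    have r1 : ∫⁻ x in X, φ (firstDigit x) * F x * ψ (T x)
        = ∫⁻ x in X, F x * (φ (firstDigit x) * ψ (T x)) :=
      lintegral_congr fun x => by ring
    have r2 : ∫⁻ x in X, φ' (firstDigit x) * F' x * ψ (T x)
        = ∫⁻ x in X, F' x * (φ' (firstDigit x) * ψ (T x)) :=
      lintegral_congr fun x => by ring
    have hmS : Measurable fun x => g (S k x v) := measurable_from_top.comp (measurable_S k v)
    have hm1 : Measurable fun x => dens x * (g (S k x v) *
        (φ (firstDigit (T^[k] x)) * ψ (T (T^[k] x)))) :=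
      measurable_dens.mul (hmS.mul (((hm φ).mul hψT).comp (measurable_T.iterate k)))
    rw [r1, r2, ← a1, ← a2, ← lintegral_add_left hm1]
    refine lintegral_congr fun x => ?_
    rw [S_succ, Function.iterate_succ_apply', ← mul_add]
    congr 1
    by_cases h : v < (firstDigit (T^[k] x) : ℝ) <;> simp [hφ, hφ', h]

/-! ### Decorrelation of exceedances. -/

theorem lintegral_mu {F : ℝ → ℝ≥0∞} (hF : Measurable F) :
    ∫⁻ x, F x ∂mu = ∫⁻ x in X, dens x * F x :=
  lintegral_withDensity_eq_lintegral_mul _ measurable_dens hF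

instance : IsProbabilityMeasure mu := by
  constructor
  rw [← lintegral_one, lintegral_mu measurable_const]
  simpa using lintegral_dens

/-- The indicator function of the event that the digit number `k + 1` exceeds `v`. -/
def exc (v : ℝ) (k : ℕ) (x : ℝ) : ℝ := if v < (firstDigit (T^[k] x) : ℝ) then 1 else 0

/-- The probability that a digit exceeds `v`. -/
def excProb (v : ℝ) : ℝ := ∫ x, exc v 0 x ∂mu

theorem exc_nonneg (v : ℝ) (k : ℕ) (x : ℝ) : 0 ≤ exc v k x := by
  unfold exc; split_ifs <;> norm_num

theorem exc_le_one (v : ℝ) (k : ℕ) (x : ℝ) : exc v k x ≤ 1 := by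
  unfold exc; split_ifs <;> norm_num

theorem measurable_exc (v : ℝ) (k : ℕ) : Measurable (exc v k) := by
  unfold exc
  exact Measurable.ite (measurableSet_lt measurable_const (measurable_from_top.comp
      (measurable_firstDigit.comp (measurable_T.iterate k)))) measurable_const measurable_const

theorem exc_comp_iterate (v : ℝ) (k m : ℕ) (x : ℝ) : exc v m (T^[k] x) = exc v (m + k) x := by
  simp only [exc, Function.iterate_add_apply]

theorem integrable_of_abs_le {f : ℝ → ℝ} (hf : Measurable f) (C : ℝ) (h : ∀ x, |f x| ≤ C) :
    Integrable f mu :=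
  Integrable.of_bound hf.aestronglyMeasurable C (Filter.Eventually.of_forall h)

theorem ofReal_integral_mu {f : ℝ → ℝ} (hf : Measurable f) (C : ℝ) (h0 : ∀ x, 0 ≤ f x)
    (h : ∀ x, f x ≤ C) :
    ENNReal.ofReal (∫ x, f x ∂mu) = ∫⁻ x in X, dens x * ENNReal.ofReal (f x) := by
  rw [ofReal_integral_eq_lintegral_ofReal (integrable_of_abs_le hf C fun x => by
    rw [abs_of_nonneg (h0 x)]; exact h x) (Filter.Eventually.of_forall h0), lintegral_mu hf.ennreal_ofReal]

theorem excProb_nonneg (v : ℝ) : 0 ≤ excProb v := integral_nonneg fun x => exc_nonneg v 0 x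

theorem ofReal_excProb (v : ℝ) :
    ENNReal.ofReal (excProb v) = ∫⁻ x in X, dens x * ENNReal.ofReal (exc v 0 x) :=
  ofReal_integral_mu (measurable_exc v 0) 1 (exc_nonneg v 0) (exc_le_one v 0)

theorem integral_exc (v : ℝ) (k : ℕ) : ∫ x, exc v k x ∂mu = excProb v := by
  have h := ofReal_integral_mu (measurable_exc v k) 1 (exc_nonneg v k) (exc_le_one v k)
  have h2 := lintegral_dens_comp_iterate k (measurable_exc v 0).ennreal_ofReal
  simp only [exc_comp_iterate, zero_add] at h2
  rw [h2, ← ofReal_excProb] at h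
  exact (ENNReal.ofReal_eq_ofReal_iff (integral_nonneg fun x => exc_nonneg v k x)
    (excProb_nonneg v)).1 h

theorem abs_sub_le_of_ofReal {J c p ρ : ℝ} (hJ : 0 ≤ J) (hc : 0 ≤ c) (hp : 0 ≤ p) (hρ : 0 ≤ ρ)
    (hρ1 : ρ ≤ 1)
    (h1 : ENNReal.ofReal (1 - ρ) * ENNReal.ofReal c * ENNReal.ofReal p ≤ ENNReal.ofReal J)
    (h2 : ENNReal.ofReal J ≤ ENNReal.ofReal (1 - ρ) * ENNReal.ofReal c * ENNReal.ofReal p +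
      ENNReal.ofReal ρ * (18 * ENNReal.ofReal c * ENNReal.ofReal p)) :
    |J - c * p| ≤ 18 * ρ * (c * p) := by
  have h1ρ : 0 ≤ 1 - ρ := by linarith
  rw [← ENNReal.ofReal_ofNat, ← ENNReal.ofReal_mul (by positivity), ← ENNReal.ofReal_mul
    (by positivity), ← ENNReal.ofReal_mul (by positivity), ← ENNReal.ofReal_mul (by positivity),
    ← ENNReal.ofReal_mul (by positivity), ← ENNReal.ofReal_add (by positivity) (by positivity),
    ENNReal.ofReal_le_ofReal_iff (by positivity)] at h2
  rw [← ENNReal.ofReal_mul (by positivity), ← ENNReal.ofReal_mul (by positivity),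
    ENNReal.ofReal_le_ofReal_iff hJ] at h1
  have : 0 ≤ ρ * (c * p) := by positivity
  rw [abs_le]
  constructor <;> nlinarith

theorem abs_integral_mul_exc_sub_le_of_nonneg (v : ℝ) (k m : ℕ) {g : ℕ → ℝ} (h0 : ∀ s, 0 ≤ g s)
    (h1 : ∀ s, g s ≤ 1) :
    |∫ x, g (S k x v) * exc v (m + k) x ∂mu - (∫ x, g (S k x v) ∂mu) * excProb v|
      ≤ 18 * (1 - gap) ^ m * excProb v := by
  have hg0 := gap_pos
  have hg1 := gap_lt_one
  have hmS : Measurable fun x => g (S k x v) := measurable_from_top.comp (measurable_S k v)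
  have hc0 : 0 ≤ ∫ x, g (S k x v) ∂mu := integral_nonneg fun x => h0 _
  have hc1 : ∫ x, g (S k x v) ∂mu ≤ 1 := by
    have : ∫ x, g (S k x v) ∂mu ≤ ∫ _, (1 : ℝ) ∂mu :=
      integral_mono_of_nonneg (Filter.Eventually.of_forall fun x => h0 _) (integrable_const 1)
        (Filter.Eventually.of_forall fun x => h1 _)
    simpa using this
  obtain ⟨F, hFm, hF, hFi⟩ := exists_logLip_density v k fun s => ENNReal.ofReal (g s)
  have hFc : ∫⁻ x in X, F x = ENNReal.ofReal (∫ x, g (S k x v) ∂mu) := by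
    rw [ofReal_integral_mu hmS 1 (fun x => h0 _) fun x => h1 _]
    simpa using (hFi (fun _ => 1) measurable_const).symm
  have hJ : ENNReal.ofReal (∫ x, g (S k x v) * exc v (m + k) x ∂mu)
      = ∫⁻ x in X, F x * ENNReal.ofReal (exc v 0 (T^[m] x)) := by
    rw [ofReal_integral_mu (f := fun x => g (S k x v) * exc v (m + k) x)
      (hmS.mul (measurable_exc v _)) 1
      (fun x => mul_nonneg (h0 _) (exc_nonneg _ _ _))
      fun x => mul_le_one₀ (h1 _) (exc_nonneg _ _ _) (exc_le_one _ _ _),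
      ← hFi (fun x => ENNReal.ofReal (exc v 0 (T^[m] x))) ((measurable_exc v 0).comp (measurable_T.iterate m)).ennreal_ofReal]
    refine lintegral_congr fun x => ?_
    rw [exc_comp_iterate, exc_comp_iterate, zero_add, ENNReal.ofReal_mul (h0 _)]
  have hmix := hF.mixing m hFm (by rw [hFc]; exact ENNReal.ofReal_ne_top)
    (measurable_exc v 0).ennreal_ofReal
  rw [← hJ, hFc, ← ofReal_excProb] at hmix
  refine (abs_sub_le_of_ofReal (integral_nonneg fun x => mul_nonneg (h0 _) (exc_nonneg _ _ _))
    hc0 (excProb_nonneg v) (pow_nonneg (by linarith) m) (pow_le_one₀ (by linarith) (by linarith))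
    hmix.1 hmix.2).trans ?_
  have : 0 ≤ (1 - gap) ^ m := pow_nonneg (by linarith) m
  gcongr
  exact mul_le_of_le_one_left (excProb_nonneg v) hc1

theorem integrable_comp_S (v : ℝ) (k : ℕ) {g : ℕ → ℝ} {C : ℝ} (hg : ∀ s, |g s| ≤ C) :
    Integrable (fun x => g (S k x v)) mu :=
  integrable_of_abs_le (measurable_from_top.comp (measurable_S k v)) C fun _ => hg _

theorem integrable_mul_exc {f : ℝ → ℝ} (hf : Integrable f mu) (v : ℝ) (k : ℕ) :
    Integrable (fun x => f x * exc v k x) mu :=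
  hf.mul_bdd (c := 1) (measurable_exc v k).aestronglyMeasurable (Filter.Eventually.of_forall fun x => by
    rw [Real.norm_eq_abs, abs_of_nonneg (exc_nonneg v k x)]; exact exc_le_one v k x)

/-- The number of exceedances up to time `k` is almost independent of later exceedances. -/
theorem abs_integral_mul_exc_sub_le (v : ℝ) (k m : ℕ) {g : ℕ → ℝ} (hg : ∀ s, |g s| ≤ 2) :
    |∫ x, g (S k x v) * exc v (m + k) x ∂mu - (∫ x, g (S k x v) ∂mu) * excProb v|
      ≤ 72 * (1 - gap) ^ m * excProb v := by
  -- Rescaling `[-2, 2]` to `[0, 1]` multiplies the constant 18 by 4.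
  have h := abs_integral_mul_exc_sub_le_of_nonneg v k m (g := fun s => (g s + 2) / 4)
    (fun s => by have := abs_le.1 (hg s); linarith) (fun s => by have := abs_le.1 (hg s); linarith)
  have i1 := integrable_comp_S v k hg
  have i2 := integrable_mul_exc i1 v (m + k)
  have i3 : Integrable (exc v (m + k)) mu := by
    simpa using integrable_mul_exc (integrable_const (1 : ℝ)) v (m + k)
  have e1 : ∫ x, (g (S k x v) + 2) / 4 ∂mu = (∫ x, g (S k x v) ∂mu) / 4 + 1 / 2 := by
    rw [integral_div, integral_add i1 (integrable_const _)]
    simp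
    ring
  have e2 : ∫ x, (g (S k x v) + 2) / 4 * exc v (m + k) x ∂mu
      = (∫ x, g (S k x v) * exc v (m + k) x ∂mu) / 4 + 1 / 2 * excProb v := by
    rw [← integral_exc v (m + k), ← integral_div, ← integral_const_mul,
      ← integral_add (i2.div_const 4) (i3.const_mul _)]
    refine integral_congr_ae (Filter.Eventually.of_forall fun x => ?_)
    simp only
    ring
  rw [e1, e2] at h
  have e3 : (∫ x, g (S k x v) * exc v (m + k) x ∂mu) / 4 + 1 / 2 * excProb v -
      ((∫ x, g (S k x v) ∂mu) / 4 + 1 / 2) * excProb v =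
      (∫ x, g (S k x v) * exc v (m + k) x ∂mu - (∫ x, g (S k x v) ∂mu) * excProb v) / 4 := by ring
  rw [e3, abs_div, abs_of_pos (by norm_num : (0 : ℝ) < 4), div_le_iff₀ (by norm_num)] at h
  linarith

/-- After an exceedance the orbit has density `transfer φ dens`, of mass `excProb v` and still
log-Lipschitz. Mixing then bounds a second exceedance by `O(p²)` even when it comes immediately
afterwards. -/
theorem integral_exc_mul_exc_le (v : ℝ) (j m : ℕ) :
    ∫ x, exc v j x * exc v (m + 1 + j) x ∂mu ≤ 18 * excProb v ^ 2 := by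
  have hg0 := gap_pos
  have hg1 := gap_lt_one
  set φ : ℕ → ℝ≥0∞ := fun b => if v < (b : ℝ) then 1 else 0 with hφ
  have hφe : ∀ x, φ (firstDigit x) = ENNReal.ofReal (exc v 0 x) := by
    intro x
    by_cases h : v < (firstDigit x : ℝ) <;> simp [hφ, exc, h]
  have hm0 : Measurable fun x => ENNReal.ofReal (exc v 0 x) := (measurable_exc v 0).ennreal_ofReal
  have hmm : Measurable fun x => ENNReal.ofReal (exc v 0 (T^[m] x)) :=
    hm0.comp (measurable_T.iterate m)
  have hJ : ENNReal.ofReal (∫ x, exc v j x * exc v (m + 1 + j) x ∂mu)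
      = ∫⁻ x in X, transfer φ dens x * ENNReal.ofReal (exc v 0 (T^[m] x)) := by
    rw [lintegral_transfer_mul φ measurable_dens hmm,
      ofReal_integral_mu (f := fun x => exc v j x * exc v (m + 1 + j) x)
      ((measurable_exc v _).mul (measurable_exc v _)) 1
      (fun x => mul_nonneg (exc_nonneg _ _ _) (exc_nonneg _ _ _))
      fun x => mul_le_one₀ (exc_le_one _ _ _) (exc_nonneg _ _ _) (exc_le_one _ _ _)]
    have hψ : Measurable fun x => ENNReal.ofReal (exc v 0 x * exc v (m + 1) x) :=
      ((measurable_exc v _).mul (measurable_exc v _)).ennreal_ofReal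
    have := lintegral_dens_comp_iterate j hψ
    simp only [exc_comp_iterate, zero_add] at this
    rw [this]
    refine lintegral_congr fun x => ?_
    rw [hφe, ← Function.iterate_succ_apply, exc_comp_iterate, zero_add,
      ENNReal.ofReal_mul (exc_nonneg _ _ _)]
    ring
  have hf : LogLip 2 (transfer φ dens) :=
    (logLip_transfer (by norm_num) φ logLip_dens).mono (by norm_num)
  have hc : ∫⁻ x in X, transfer φ dens x = ENNReal.ofReal (excProb v) := by
    have := lintegral_transfer_mul φ measurable_dens (ψ := fun _ => 1) measurable_const
    simp only [mul_one, hφe] at this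
    rw [this, ofReal_excProb]
    exact lintegral_congr fun x => mul_comm _ _
  have hmix := hf.mixing m (measurable_transfer φ measurable_dens)
    (by rw [hc]; exact ENNReal.ofReal_ne_top) hm0
  rw [← hJ, hc, ← ofReal_excProb] at hmix
  have hp := excProb_nonneg v
  have hρ : 0 ≤ (1 - gap) ^ m := pow_nonneg (by linarith) m
  have hρ1 : (1 - gap) ^ m ≤ 1 := pow_le_one₀ (by linarith) (by linarith)
  have hub := hmix.2
  have h1ρ : 0 ≤ 1 - (1 - gap) ^ m := by linarith
  rw [← ENNReal.ofReal_ofNat, ← ENNReal.ofReal_mul (by positivity), ← ENNReal.ofReal_mul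
    (by positivity), ← ENNReal.ofReal_mul (by positivity), ← ENNReal.ofReal_mul (by positivity),
    ← ENNReal.ofReal_mul (by positivity), ← ENNReal.ofReal_add (by positivity) (by positivity),
    ENNReal.ofReal_le_ofReal_iff (by positivity)] at hub
  nlinarith [mul_nonneg h1ρ (sq_nonneg (excProb v))]

theorem abs_exc_sub_le (v : ℝ) (c : ℕ) (x : ℝ) : |exc v c x - excProb v| ≤ exc v c x + excProb v := by
  have := exc_nonneg v c x
  have := excProb_nonneg v
  rw [abs_le]
  constructor <;> linarith

theorem S_succ_eq (v : ℝ) (k : ℕ) (x : ℝ) (g : ℕ → ℝ) :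
    g (S (k + 1) x v) = g (S k x v) + (g (S k x v + 1) - g (S k x v)) * exc v k x := by
  rw [S_succ, exc]
  split_ifs <;> simp

theorem integrable_mul_exc_sub {f : ℝ → ℝ} (hf : Integrable f mu) (v : ℝ) (c : ℕ) :
    Integrable (fun x => f x * (exc v c x - excProb v)) mu := by
  simp only [mul_sub]
  exact (integrable_mul_exc hf v c).sub (hf.mul_const _)

/-- The count changes in one step only at an exceedance, so dropping that step costs at most `4 *
(18 p² + p²) = 76 p²`. In the induction `m` grows as `d` shrinks, which keeps the later exceedance
fixed. -/
theorem abs_integral_shift_le (v : ℝ) (a d m : ℕ) {g : ℕ → ℝ} (hg : ∀ s, |g s| ≤ 2) :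
    |∫ x, g (S (a + d) x v) * (exc v (m + (a + d)) x - excProb v) ∂mu -
      ∫ x, g (S a x v) * (exc v (m + (a + d)) x - excProb v) ∂mu| ≤ 76 * d * excProb v ^ 2 := by
  induction d generalizing m with
  | zero => simp
  | succ d ih =>
    have h1 := ih (m + 1)
    have e : m + 1 + (a + d) = m + (a + (d + 1)) := by ring
    rw [e] at h1
    set c := m + (a + (d + 1)) with hc
    have i1 := integrable_mul_exc_sub (integrable_comp_S v (a + (d + 1)) hg) v c
    have i2 := integrable_mul_exc_sub (integrable_comp_S v (a + d) hg) v c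
    have hi : ∀ k, Integrable (exc v k) mu := fun k => by
      simpa using integrable_mul_exc (integrable_const (1 : ℝ)) v k
    have h2 : |∫ x, g (S (a + (d + 1)) x v) * (exc v c x - excProb v) ∂mu -
        ∫ x, g (S (a + d) x v) * (exc v c x - excProb v) ∂mu| ≤ 76 * excProb v ^ 2 := by
      rw [← integral_sub i1 i2, ← Real.norm_eq_abs]
      have hb : ∀ x, ‖g (S (a + (d + 1)) x v) * (exc v c x - excProb v) -
          g (S (a + d) x v) * (exc v c x - excProb v)‖ ≤
          4 * (exc v (a + d) x * exc v c x + excProb v * exc v (a + d) x) := by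
        intro x
        have e1 : g (S (a + (d + 1)) x v) * (exc v c x - excProb v) -
          g (S (a + d) x v) * (exc v c x - excProb v) = (g (S (a + d) x v + 1) - g (S (a + d) x v)) *
            exc v (a + d) x * (exc v c x - excProb v) := by
          rw [← add_assoc, S_succ_eq v _ x g]
          ring
        rw [e1, Real.norm_eq_abs, abs_mul, abs_mul, abs_of_nonneg (exc_nonneg v (a + d) x)]
        have h4 : |g (S (a + d) x v + 1) - g (S (a + d) x v)| ≤ 4 := by
          have h5 := abs_le.1 (hg (S (a + d) x v + 1))
          have h6 := abs_le.1 (hg (S (a + d) x v))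
          rw [abs_le]
          constructor <;> linarith
        have h7 := abs_exc_sub_le v c x
        have h8 := exc_nonneg v (a + d) x
        calc _ ≤ 4 * exc v (a + d) x * (exc v c x + excProb v) := by gcongr
          _ = _ := by ring
      have ib : Integrable (fun x => 4 * (exc v (a + d) x * exc v c x +
          excProb v * exc v (a + d) x)) mu :=
        ((integrable_mul_exc (hi _) v c).add ((hi _).const_mul _)).const_mul 4
      refine (norm_integral_le_of_norm_le ib (Filter.Eventually.of_forall hb)).trans ?_
      rw [integral_const_mul, integral_add (integrable_mul_exc (hi _) v c) ((hi _).const_mul _),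
        integral_const_mul, integral_exc]
      have := integral_exc_mul_exc_le v (a + d) m
      rw [show m + 1 + (a + d) = c by rw [hc]; ring] at this
      nlinarith
    rw [abs_le] at h1 h2 ⊢
    push_cast
    constructor <;> linarith

theorem integral_mul_exc_sub {v : ℝ} {k c : ℕ} {g : ℕ → ℝ} (hg : ∀ s, |g s| ≤ 2) :
    ∫ x, g (S k x v) * (exc v c x - excProb v) ∂mu =
      ∫ x, g (S k x v) * exc v c x ∂mu - (∫ x, g (S k x v) ∂mu) * excProb v := by
  have i1 := integrable_comp_S v k hg
  simp only [mul_sub]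
  rw [integral_sub (integrable_mul_exc i1 v c) (i1.mul_const _), integral_mul_const]

/-- An exceedance is almost uncorrelated with the number of exceedances before it. -/
theorem abs_integral_decouple_le (v : ℝ) (k m : ℕ) {g : ℕ → ℝ} (hg : ∀ s, |g s| ≤ 2) :
    |∫ x, g (S k x v) * (exc v k x - excProb v) ∂mu|
      ≤ 72 * (1 - gap) ^ m * excProb v + 76 * m * excProb v ^ 2 := by
  have hg1 := gap_lt_one
  have hp := excProb_nonneg v
  rcases le_or_gt m k with h | h
  · obtain ⟨a, rfl⟩ := Nat.exists_eq_add_of_le h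
    have h1 := abs_integral_shift_le v a m 0 hg
    have h2 := abs_integral_mul_exc_sub_le v a m hg
    rw [← integral_mul_exc_sub hg] at h2
    rw [zero_add, add_comm a m] at h1
    rw [abs_le] at h1 h2 ⊢
    constructor <;> linarith
  -- With fewer than `m` digits behind, go back to the empty count, which is deterministic and gives
  -- correlation exactly zero.
  · have h1 := abs_integral_shift_le v 0 k 0 hg
    rw [zero_add, zero_add] at h1
    have h2 : ∫ x, g (S 0 x v) * (exc v k x - excProb v) ∂mu = 0 := by
      rw [integral_mul_exc_sub hg]
      simp only [S_zero]
      rw [integral_const_mul, integral_exc]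
      simp
    rw [h2, sub_zero] at h1
    have h3 : (k : ℝ) ≤ m := by exact_mod_cast h.le
    have h4 : 0 ≤ 72 * (1 - gap) ^ m * excProb v := by
      have : 0 ≤ (1 - gap) ^ m := pow_nonneg (by linarith) m
      positivity
    have h5 : 76 * (k : ℝ) * excProb v ^ 2 ≤ 76 * m * excProb v ^ 2 := by gcongr
    linarith

/-! ### The tail of a single digit. -/

theorem density_add_density_neg {x : ℝ} (h0 : 0 < x) (h1 : x < 1 / 2) :
    1 / Real.log Real.goldenRatio * (1 - x) ≤ density x + density (-x) ∧
      density x + density (-x) ≤ 1 / Real.log Real.goldenRatio := by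
  have hG1 := Real.one_lt_goldenRatio
  have hG2 := log_goldenRatio_pos
  have hG3 := Real.goldenRatio_sq
  rw [density, density, if_pos h0.le, if_neg (by linarith), ← mul_add]
  generalize Real.goldenRatio = G at *
  have p1 : 0 < G + x := by linarith
  have p2 : 0 < G + 1 + -x := by linarith
  have e : 1 / (G + x) + 1 / (G + 1 + -x) = (2 * G + 1) / ((G + x) * (G + 1 + -x)) := by
    field_simp
    ring
  have e2 : (G + x) * (G + 1 + -x) = 2 * G + 1 + x * (1 - x) := by linear_combination hG3
  have hx : 0 ≤ x * (1 - x) := mul_nonneg h0.le (by linarith)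
  rw [e, e2]
  constructor
  · refine mul_le_mul_of_nonneg_left ?_ (by positivity)
    rw [le_div_iff₀ (by linarith)]
    nlinarith [mul_nonneg hx h0.le]
  · refine mul_le_of_le_one_right (by positivity) ?_
    rw [div_le_one (by linarith)]
    linarith

theorem excProb_le_one (v : ℝ) : excProb v ≤ 1 := by
  have : excProb v ≤ ∫ _, (1 : ℝ) ∂mu :=
    integral_mono_of_nonneg (Filter.Eventually.of_forall fun x => exc_nonneg v 0 x)
      (integrable_const 1) (Filter.Eventually.of_forall fun x => exc_le_one v 0 x)
  simpa using this

theorem lt_firstDigit_iff {v x : ℝ} (hv : 0 ≤ v) (hx : 0 < x) :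
    v < (firstDigit x : ℝ) ↔ x ≤ 1 / (⌊v⌋₊ + 1 / 2) := by
  rw [firstDigit, abs_of_pos (by positivity), ← Nat.floor_lt hv, ← Nat.add_one_le_iff,
    Nat.le_floor_iff (by positivity), le_div_iff₀ (by positivity), mul_comm, ← le_div_iff₀ hx]
  push_cast
  constructor <;> intro h <;> linarith

/-- On `X`, up to the null point `0`, an exceedance means `|x| ≤ 1 / (⌊v⌋₊ + 1 / 2)`. There the
symmetrised density lies between `(1 - |x|) / log G` and `1 / log G`. -/
theorem excProb_bounds {v : ℝ} (hv : 2 ≤ v) :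
    1 / Real.log Real.goldenRatio * (1 - 1 / (⌊v⌋₊ + 1 / 2)) * (1 / (⌊v⌋₊ + 1 / 2)) ≤ excProb v ∧
      excProb v ≤ 1 / Real.log Real.goldenRatio * (1 / (⌊v⌋₊ + 1 / 2)) := by
  have hG2 := log_goldenRatio_pos
  have hN : (2 : ℝ) ≤ ⌊v⌋₊ := by exact_mod_cast Nat.le_floor (by exact_mod_cast hv)
  set η : ℝ := 1 / (⌊v⌋₊ + 1 / 2) with hη
  have hη0 : 0 < η := by positivity
  have hη1 : η < 1 / 2 := one_div_lt_one_div_of_lt (by norm_num) (by linarith)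
  have hmeas : Measurable fun x => ENNReal.ofReal (exc v 0 x) := (measurable_exc v 0).ennreal_ofReal
  have e : ENNReal.ofReal (excProb v)
      = ∫⁻ x in Set.Ioc 0 η, ENNReal.ofReal (density x + density (-x)) := by
    rw [ofReal_excProb, lintegral_X_eq (F := fun x => dens x * ENNReal.ofReal (exc v 0 x))
      (measurable_dens.mul hmeas)]
    have hsub : Set.Ioc 0 η = Set.Iic η ∩ Set.Ioo 0 (1 / 2) := by
      ext x
      simp only [Set.mem_Ioc, Set.mem_inter_iff, Set.mem_Iic, Set.mem_Ioo]
      constructor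
      · rintro ⟨h1, h2⟩
        exact ⟨h2, h1, by linarith⟩
      · rintro ⟨h1, h2, h3⟩
        exact ⟨h2, h1⟩
    rw [hsub, ← Measure.restrict_restrict measurableSet_Iic, ← lintegral_indicator measurableSet_Iic]
    refine setLIntegral_congr_fun measurableSet_Ioo ?_
    rintro x ⟨h1, h2⟩
    have hiff := lt_firstDigit_iff (by linarith : 0 ≤ v) h1
    by_cases h : x ≤ η
    · have := hiff.2 h
      simp [exc, firstDigit_neg, this, Set.indicator, h, dens,
        ENNReal.ofReal_add (density_nonneg (by linarith : -(1 / 2) ≤ x))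
          (density_nonneg (by linarith : -(1 / 2) ≤ -x))]
    · have := mt hiff.1 h
      simp [exc, firstDigit_neg, this, Set.indicator, h]
  have hvol : volume (Set.Ioc 0 η) = ENNReal.ofReal η := by simp
  constructor
  · have h1 : ∫⁻ _ in Set.Ioc 0 η, ENNReal.ofReal (1 / Real.log Real.goldenRatio * (1 - η))
        ≤ ENNReal.ofReal (excProb v) := by
      rw [e]
      refine setLIntegral_mono' measurableSet_Ioc fun x hx => ENNReal.ofReal_le_ofReal ?_
      refine le_trans ?_ (density_add_density_neg hx.1 (by linarith [hx.2])).1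
      have := hx.2
      gcongr
    rw [setLIntegral_const, hvol, ← ENNReal.ofReal_mul
      (mul_nonneg (by positivity) (by linarith)),
      ENNReal.ofReal_le_ofReal_iff (excProb_nonneg v)] at h1
    exact h1
  · have h1 : ENNReal.ofReal (excProb v) ≤
        ∫⁻ _ in Set.Ioc 0 η, ENNReal.ofReal (1 / Real.log Real.goldenRatio) := by
      rw [e]
      exact setLIntegral_mono' measurableSet_Ioc fun x hx => ENNReal.ofReal_le_ofReal
        (density_add_density_neg hx.1 (by linarith [hx.2])).2
    rw [setLIntegral_const, hvol, ← ENNReal.ofReal_mul (by positivity),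
      ENNReal.ofReal_le_ofReal_iff (by positivity)] at h1
    exact h1

theorem abs_excProb_mul_log_sub_le {v : ℝ} (hv : 0 < v) :
    |excProb v * Real.log Real.goldenRatio - 1 / v| ≤ 4 * (1 / v) ^ 2 := by
  have hG2 := log_goldenRatio_pos
  have hG3 := log_goldenRatio_lt_one
  have hp0 := excProb_nonneg v
  have hp1 := excProb_le_one v
  have hv' : 0 < 1 / v := by positivity
  rcases lt_or_ge v 2 with h | h
  -- For small levels the claim is trivial, since `4 * (1 / v) ^ 2` exceeds both `1` and `1 / v`.
  · have h2 : 1 / 2 < 1 / v := one_div_lt_one_div_of_lt hv h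
    have h3 : excProb v * Real.log Real.goldenRatio ≤ 1 := mul_le_one₀ hp1 hG2.le hG3.le
    have h4 : 0 ≤ excProb v * Real.log Real.goldenRatio := by positivity
    rw [abs_le]
    constructor <;> nlinarith
  · obtain ⟨hb1, hb2⟩ := excProb_bounds h
    have hN1 := Nat.floor_le hv.le
    have hN2 := Nat.lt_floor_add_one v
    set N : ℝ := (⌊v⌋₊ : ℝ)
    set η : ℝ := 1 / (N + 1 / 2) with hη
    have hNη : 3 / 4 * v ≤ N + 1 / 2 := by linarith
    have hη0 : 0 < η := one_div_pos.2 (by linarith)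
    have hη2 : η ≤ 4 / 3 * (1 / v) := by
      calc η ≤ 1 / (3 / 4 * v) := one_div_le_one_div_of_le (by positivity) hNη
        _ = _ := by field_simp
    have hd : |η - 1 / v| ≤ (1 / v) ^ 2 := by
      have h1 : (N + 1 / 2) * η = 1 := mul_one_div_cancel (by linarith)
      have h2 : v * (1 / v) = 1 := mul_one_div_cancel hv.ne'
      have e : η - 1 / v = (v - N - 1 / 2) * η * (1 / v) := by
        linear_combination (-η) * h2 + 1 / v * h1
      have h5 : |v - N - 1 / 2| ≤ 1 / 2 := by rw [abs_le]; constructor <;> linarith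
      rw [e, abs_mul, abs_mul, abs_of_pos hη0, abs_of_pos hv']
      calc _ ≤ 1 / 2 * (4 / 3 * (1 / v)) * (1 / v) := by gcongr
        _ ≤ _ := by nlinarith
    have hη3 : η ^ 2 ≤ 2 * (1 / v) ^ 2 := by
      calc η ^ 2 ≤ (4 / 3 * (1 / v)) ^ 2 := by gcongr
        _ ≤ _ := by nlinarith [sq_nonneg (1 / v)]
    have hb1' : η - η ^ 2 ≤ excProb v * Real.log Real.goldenRatio := by
      have := mul_le_mul_of_nonneg_right hb1 hG2.le
      calc η - η ^ 2 = 1 / Real.log Real.goldenRatio * (1 - η) * η * Real.log Real.goldenRatio := by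
            field_simp
        _ ≤ _ := this
    have hb2' : excProb v * Real.log Real.goldenRatio ≤ η := by
      have := mul_le_mul_of_nonneg_right hb2 hG2.le
      calc _ ≤ _ := this
        _ = η := by field_simp
    rw [abs_le] at hd ⊢
    constructor <;> nlinarith

theorem abs_excProb_sub_le {w : ℝ} (hw : 0 < w) :
    |excProb (w / Real.log Real.goldenRatio) - 1 / w| ≤ 4 * (1 / w) ^ 2 := by
  have hG2 := log_goldenRatio_pos
  have hG3 := log_goldenRatio_lt_one
  have h := abs_excProb_mul_log_sub_le (div_pos hw hG2)
  set L := Real.log Real.goldenRatio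
  set p := excProb (w / L)
  have e1 : p * L - 1 / (w / L) = (p - 1 / w) * L := by field_simp
  have e2 : 4 * (1 / (w / L)) ^ 2 = (4 * (1 / w) ^ 2 * L) * L := by field_simp
  rw [e1, e2, abs_mul, abs_of_pos hG2] at h
  have h' := le_of_mul_le_mul_right h hG2
  refine h'.trans (mul_le_of_le_one_right (by positivity) hG3.le)

theorem excProb_le {w : ℝ} (hw : 0 < w) :
    excProb (w / Real.log Real.goldenRatio) ≤ 5 * (1 / w) := by
  have h1 := abs_le.1 (abs_excProb_sub_le hw)
  have h2 := excProb_le_one (w / Real.log Real.goldenRatio)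
  have h3 : 0 < 1 / w := by positivity
  rcases le_total (1 / w) 1 with h | h
  · nlinarith
  · linarith

/-! ### Replacing indicators by Poisson variables. -/

/-- The expectation of `h (s + N)` for `N` a Poisson random variable with mean `r`. -/
def poissonStep (r : ℝ≥0) (h : ℕ → ℝ) (s : ℕ) : ℝ := ∫ j, h (s + j) ∂(poissonMeasure r)

theorem integrable_nat {ν : Measure ℕ} [IsFiniteMeasure ν] {f : ℕ → ℝ} (C : ℝ)
    (hf : ∀ s, |f s| ≤ C) : Integrable f ν :=
  Integrable.of_bound (measurable_from_top (f := f)).aestronglyMeasurable C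
    (Filter.Eventually.of_forall hf)

theorem abs_poissonStep_le (r : ℝ≥0) {h : ℕ → ℝ} (hh : ∀ s, |h s| ≤ 1) (s : ℕ) :
    |poissonStep r h s| ≤ 1 := by
  rw [poissonStep]
  have := norm_integral_le_of_norm_le_const (μ := poissonMeasure r) (f := fun j => h (s + j))
    (C := 1) (Filter.Eventually.of_forall fun j => hh _)
  simpa using this

theorem poissonStep_poissonStep (a b : ℝ≥0) {h : ℕ → ℝ} (hh : ∀ s, |h s| ≤ 1) (s : ℕ) :
    poissonStep a (poissonStep b h) s = poissonStep (a + b) h s := by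
  unfold poissonStep
  rw [← poissonMeasure_conv_poissonMeasure]
  rw [integral_conv]
  · simp only [add_assoc]
  · rw [poissonMeasure_conv_poissonMeasure]
    exact integrable_nat 1 fun j => hh _

theorem poissonStep_zero (h : ℕ → ℝ) (s : ℕ) : poissonStep 0 h s = h s := by
  have h0 : poissonMeasure 0 = Measure.dirac 0 := by
    refine Measure.ext_of_singleton fun n => ?_
    rw [poissonMeasure_singleton]
    rcases n with _ | n <;> simp
  rw [poissonStep, h0, integral_dirac, add_zero]

/-- A Poisson variable of small mean is nearly Bernoulli: the values at least 2 cost `2 P(N ≥ 2)`,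
and replacing `P(N = 1)` by `q` costs `2 q (1 - exp (-q))`. Each is at most `2 q²`. -/
theorem abs_poissonStep_sub_le (q : ℝ≥0) {h : ℕ → ℝ} (hh : ∀ s, |h s| ≤ 1) (s : ℕ) :
    |poissonStep q h s - (h s + q * (h (s + 1) - h s))| ≤ 4 * (q : ℝ) ^ 2 := by
  set ν := poissonMeasure q
  set i0 : ℕ → ℝ := ({0} : Set ℕ).indicator 1 with hi0
  set i1 : ℕ → ℝ := ({1} : Set ℕ).indicator 1 with hi1
  have b0 : ∀ j, |i0 j| ≤ 1 := fun j => by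
    by_cases hj : j = 0 <;> simp [hi0, hj]
  have b1 : ∀ j, |i1 j| ≤ 1 := fun j => by
    by_cases hj : j = 1 <;> simp [hi1, hj]
  have I0 : ∫ j, i0 j ∂ν = Real.exp (-q) := by
    rw [hi0, integral_indicator_one (measurableSet_singleton _), poissonMeasure_real_singleton]
    simp
  have I1 : ∫ j, i1 j ∂ν = Real.exp (-q) * q := by
    rw [hi1, integral_indicator_one (measurableSet_singleton _), poissonMeasure_real_singleton]
    simp
  have hd : |h (s + 1) - h s| ≤ 2 := by
    have h1 := abs_le.1 (hh s)
    have h2 := abs_le.1 (hh (s + 1))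
    rw [abs_le]
    constructor <;> linarith
  have hpt : ∀ j, ‖h (s + j) - (h s + i1 j * (h (s + 1) - h s))‖ ≤ 2 * (1 - i0 j - i1 j) := by
    intro j
    rcases j with _ | _ | j
    · simp [hi0, hi1]
    · simp [hi0, hi1]
    · have h1 := abs_le.1 (hh s)
      have h2 := abs_le.1 (hh (s + (j + 1 + 1)))
      simp only [hi0, hi1, Set.indicator, Set.mem_singleton_iff, Real.norm_eq_abs]
      norm_num
      rw [abs_le]
      constructor <;> linarith
  have n0 : Integrable i0 ν := integrable_nat 1 b0
  have n1 : Integrable i1 ν := integrable_nat 1 b1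
  have nh : Integrable (fun j => h (s + j)) ν := integrable_nat 1 fun j => hh _
  have nb : Integrable (fun j => 2 * (1 - i0 j - i1 j)) ν :=
    (((integrable_const 1).sub n0).sub n1).const_mul 2
  have hmain := norm_integral_le_of_norm_le nb (Filter.Eventually.of_forall hpt)
  have ne : Integrable (fun j => h s + i1 j * (h (s + 1) - h s)) ν :=
    (integrable_const _).add (n1.mul_const _)
  have e1 : ∫ j, (h (s + j) - (h s + i1 j * (h (s + 1) - h s))) ∂ν
      = poissonStep q h s - (h s + Real.exp (-q) * q * (h (s + 1) - h s)) := by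
    rw [integral_sub nh ne, integral_add (integrable_const _) (n1.mul_const _),
      integral_mul_const, I1]
    simp [poissonStep, ν]
  have e2 : ∫ j, 2 * (1 - i0 j - i1 j) ∂ν = 2 * (1 - Real.exp (-q) - Real.exp (-q) * q) := by
    have n2 : Integrable (fun j => 1 - i0 j) ν := (integrable_const 1).sub n0
    rw [integral_const_mul, integral_sub n2 n1, integral_sub (integrable_const 1) n0, I0, I1]
    simp
  rw [e1, e2, Real.norm_eq_abs] at hmain
  have hq : 0 ≤ (q : ℝ) := q.2
  have hexp1 : 1 - (q : ℝ) ≤ Real.exp (-q) := by linarith [Real.add_one_le_exp (-(q : ℝ))]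
  have hexp2 : Real.exp (-(q : ℝ)) ≤ 1 := Real.exp_le_one_iff.2 (by linarith)
  have h3 : |(q : ℝ) * (1 - Real.exp (-q)) * (h (s + 1) - h s)| ≤ 2 * (q * (1 - Real.exp (-q))) := by
    rw [abs_mul, abs_of_nonneg (mul_nonneg hq (by linarith)), mul_comm 2]
    exact mul_le_mul_of_nonneg_left hd (mul_nonneg hq (by linarith))
  rw [abs_le] at hmain h3 ⊢
  constructor <;> nlinarith

/-- The error made in replacing one indicator by a Poisson variable of mean `q`, when the
dependence is cut off at distance `m`. -/
def stepError (v : ℝ) (m : ℕ) (q : ℝ) : ℝ :=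
  72 * (1 - gap) ^ m * excProb v + 76 * m * excProb v ^ 2 + 2 * |excProb v - q| + 4 * q ^ 2

theorem abs_integral_succ_sub_le (v : ℝ) (m k : ℕ) (q : ℝ≥0) {h : ℕ → ℝ} (hh : ∀ s, |h s| ≤ 1) :
    |∫ x, h (S (k + 1) x v) ∂mu - ∫ x, poissonStep q h (S k x v) ∂mu| ≤ stepError v m q := by
  set g : ℕ → ℝ := fun s => h (s + 1) - h s with hgdef
  have hg : ∀ s, |g s| ≤ 2 := fun s => by
    have h1 := abs_le.1 (hh s)
    have h2 := abs_le.1 (hh (s + 1))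
    rw [abs_le]
    constructor <;> simp only [hgdef] <;> linarith
  have nh := integrable_comp_S v k hh
  have ng := integrable_comp_S v k hg
  have np := integrable_comp_S v k (g := poissonStep q h) (abs_poissonStep_le q hh)
  have nge := integrable_mul_exc_sub ng v k
  have h1 := abs_integral_decouple_le v k m hg
  have h2 : |∫ x, (poissonStep q h (S k x v) - (h (S k x v) + q * g (S k x v))) ∂mu|
      ≤ 4 * (q : ℝ) ^ 2 := by
    have := norm_integral_le_of_norm_le_const (μ := mu)
      (f := fun x => poissonStep q h (S k x v) - (h (S k x v) + q * g (S k x v)))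
      (Filter.Eventually.of_forall fun x => abs_poissonStep_sub_le q hh (S k x v))
    simpa using this
  have h3 : |∫ x, (excProb v - q) * g (S k x v) ∂mu| ≤ 2 * |excProb v - q| := by
    have := norm_integral_le_of_norm_le_const (μ := mu)
      (f := fun x => (excProb v - q) * g (S k x v)) (C := 2 * |excProb v - q|)
      (Filter.Eventually.of_forall fun x => by
        rw [Real.norm_eq_abs, abs_mul, mul_comm]
        exact mul_le_mul_of_nonneg_right (hg _) (abs_nonneg _))
    simpa using this
  -- The three terms are the correlation with the past, the change of mean from `excProb v` to `q`,
  -- and the passage from Bernoulli to Poisson.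
  have e : ∫ x, h (S (k + 1) x v) ∂mu - ∫ x, poissonStep q h (S k x v) ∂mu =
      ∫ x, g (S k x v) * (exc v k x - excProb v) ∂mu +
        ∫ x, (excProb v - q) * g (S k x v) ∂mu -
        ∫ x, (poissonStep q h (S k x v) - (h (S k x v) + q * g (S k x v))) ∂mu := by
    have n1 : Integrable (fun x => g (S k x v) * (exc v k x - excProb v) +
        (excProb v - q) * g (S k x v)) mu := nge.add (ng.const_mul _)
    have n2 : Integrable (fun x => poissonStep q h (S k x v) -
        (h (S k x v) + q * g (S k x v))) mu := np.sub (nh.add (ng.const_mul _))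
    rw [← integral_add nge (ng.const_mul _), ← integral_sub n1 n2,
      ← integral_sub (integrable_comp_S v (k + 1) hh) np]
    refine integral_congr_ae (Filter.Eventually.of_forall fun x => ?_)
    simp only [S_succ_eq v k x h, hgdef]
    ring
  rw [e, stepError]
  rw [abs_le] at h1 h2 h3 ⊢
  constructor <;> linarith

/-- The last indicator is replaced first. This turns `h` into `poissonStep q h`, which has the same
bound, so the induction must range over all `h`. -/
theorem abs_integral_sub_poissonStep_le (v : ℝ) (m n : ℕ) (q : ℝ≥0) :
    ∀ {h : ℕ → ℝ}, (∀ s, |h s| ≤ 1) →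
      |∫ x, h (S n x v) ∂mu - poissonStep (n * q) h 0| ≤ n * stepError v m q := by
  induction n with
  | zero =>
    intro h _
    simp [S_zero, poissonStep_zero]
  | succ n ih =>
    intro h hh
    have h1 := abs_integral_succ_sub_le v m n q hh
    have h2 := ih (abs_poissonStep_le q hh)
    rw [poissonStep_poissonStep _ _ hh] at h2
    have e : ((n + 1 : ℕ) : ℝ≥0) * q = n * q + q := by push_cast; ring
    rw [e]
    push_cast
    rw [abs_le] at h1 h2 ⊢
    constructor <;> linarith

/-! ### From test functions to events and order statistics. -/

theorem mu_compl_X : mu Xᶜ = 0 := by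
  have : (volume.restrict X) Xᶜ = 0 := by
    rw [Measure.restrict_apply measurableSet_X.compl]
    simp
  exact withDensity_absolutelyContinuous _ _ this

theorem measureReal_inter_X (A : Set ℝ) : mu.real {x | x ∈ X ∧ x ∈ A} = mu.real A := by
  refine measureReal_congr ?_
  have : ∀ᵐ x ∂mu, x ∈ X := mu_compl_X
  filter_upwards [this] with x hx
  simp only [eq_iff_iff]
  exact ⟨fun h => h.2, fun h => ⟨hx, h⟩⟩

theorem abs_measureReal_sub_poissonMeasure_le (v : ℝ) (m n : ℕ) (q : ℝ≥0) (A : Set ℕ) :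
    |mu.real {x | x ∈ X ∧ S n x v ∈ A} - (poissonMeasure (n * q)).real A|
      ≤ n * stepError v m q := by
  have hA : MeasurableSet A := trivial
  have h := abs_integral_sub_poissonStep_le v m n q (h := A.indicator 1) fun s => by
    by_cases hs : s ∈ A <;> simp [hs]
  have e1 : ∫ x, A.indicator (1 : ℕ → ℝ) (S n x v) ∂mu = mu.real {x | x ∈ X ∧ S n x v ∈ A} := by
    refine Eq.trans ?_ (measureReal_inter_X {x | S n x v ∈ A}).symm
    exact integral_indicator_one (measurable_S n v hA)
  rw [e1] at h
  simpa [poissonStep, integral_indicator_one hA] using h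

theorem poissonMeasure_real_Iio (r : ℝ≥0) (k : ℕ) : (poissonMeasure r).real (Set.Iio k)
    = Real.exp (-r) * ∑ j ∈ Finset.range k, (r : ℝ) ^ j / j.factorial := by
  rw [← Finset.coe_range, ← sum_measureReal_singleton, Finset.mul_sum]
  simp only [poissonMeasure_real_singleton, mul_div_assoc]

/-- In a decreasing list the entries above `v` form an initial segment, so the entry of index `k`
(counted from 0) is at most `v` exactly when that segment has length at most `k`. -/
theorem getD_le_iff_countP_lt (v : ℝ) : ∀ (L : List ℕ), L.Pairwise (· ≥ ·) → ∀ k < L.length,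
    ((L.getD k 0 : ℕ) : ℝ) ≤ v ↔ L.countP (fun b : ℕ => decide (v < (b : ℝ))) ≤ k := by
  intro L
  induction L with
  | nil => intro _ k hk; simp at hk
  | cons a L ih =>
    intro hL k hk
    rw [List.pairwise_cons] at hL
    have hzero : (a : ℝ) ≤ v → L.countP (fun b : ℕ => decide (v < (b : ℝ))) = 0 := by
      intro ha
      rw [List.countP_eq_zero]
      intro b hb
      have hba : (b : ℝ) ≤ a := by exact_mod_cast hL.1 b hb
      simp only [decide_eq_true_eq, not_lt]
      linarith
    rw [List.countP_cons]
    rcases k with _ | k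
    · rcases le_or_gt (a : ℝ) v with ha | ha
      · simp [ha, hzero ha]
      · simp [ha]
    · have hk' : k < L.length := by simpa using hk
      have := ih hL.2 k hk'
      rw [List.getD_cons_succ, this]
      rcases le_or_gt (a : ℝ) v with ha | ha
      · simp [ha.not_gt, hzero ha]
      · simp [ha]

theorem Mk_le_iff {k n : ℕ} (hk : 1 ≤ k) (hkn : k ≤ n) (x v : ℝ) :
    (Mk k n x : ℝ) ≤ v ↔ S n x v < k := by
  have hS : ((((Finset.Icc 1 n).val.map fun i => digit i x).sort (· ≥ ·)).countP
      fun b : ℕ => decide (v < (b : ℝ))) = S n x v := by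
    rw [← Multiset.coe_countP, Multiset.sort_eq, Multiset.countP_map]
    rfl
  rw [Mk, kthLargest, getD_le_iff_countP_lt v _ (Multiset.pairwise_sort _ _) (k - 1) (by simp; omega), hS]
  omega

theorem M_le_iff {n : ℕ} {x v : ℝ} (hv : 0 ≤ v) : (M n x : ℝ) ≤ v ↔ S n x v < 1 := by
  rw [Nat.lt_one_iff, S, Finset.card_eq_zero, Finset.filter_eq_empty_iff, ← Nat.le_floor_iff hv, M,
    Finset.sup_le_iff]
  simp only [Nat.le_floor_iff hv, not_lt]

/-! ### Choice of the cut-off and the total error. -/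

theorem exists_gap_pow_le : ∃ K : ℕ, (1 - gap) ^ K ≤ 3 / 4 := by
  obtain ⟨K, hK⟩ := exists_pow_lt_of_lt_one (by norm_num : (0 : ℝ) < 3 / 4)
    (by linarith [gap_pos] : 1 - gap < 1)
  exact ⟨K, hK.le⟩

/-- A lower bound on `l` lets terms without a factor `l` be absorbed, and gives `⌈l⌉₊ ≤ 3 * l`. -/
theorem half_le_of_mul_rpow {l n : ℝ} (hn : 1 ≤ n) (hl : l * (3 / 4 : ℝ) ^ (-l) = n) :
    1 / 2 ≤ l := by
  by_contra! h
  have hpos : 0 < (3 / 4 : ℝ) ^ (-l) := Real.rpow_pos_of_pos (by norm_num) _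
  rcases le_or_gt l 0 with h0 | h0
  · nlinarith
  · have h1 : (3 / 4 : ℝ) ^ (-l) ≤ (3 / 4 : ℝ) ^ (-1 : ℝ) :=
      Real.rpow_le_rpow_of_exponent_ge (by norm_num) (by norm_num) (by linarith)
    rw [Real.rpow_neg_one] at h1
    nlinarith

theorem stepError_le {K n : ℕ} {l r : ℝ} (hK : (1 - gap) ^ K ≤ 3 / 4) (hn : 1 ≤ n) (hr : 0 < r)
    (hl : l * (3 / 4 : ℝ) ^ (-l) = n) :
    n * stepError (u n r) (K * ⌈l⌉₊) (1 / (n * r))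
      ≤ (5700 * K + 384) * (1 / min r (r ^ 2) * (l / n)) := by
  have hn1 : (1 : ℝ) ≤ n := by exact_mod_cast hn
  have hn0 : (0 : ℝ) < n := by linarith
  have hl2 := half_le_of_mul_rpow hn1 hl
  have hg1 := gap_lt_one
  set w : ℝ := n * r with hw
  have hw0 : 0 < w := by positivity
  set q := 1 / w with hq
  have hq0 : 0 < q := by positivity
  have hp0 := excProb_nonneg (u n r)
  have hp1 : excProb (u n r) ≤ 5 * q := excProb_le hw0
  have hp2 : |excProb (u n r) - q| ≤ 4 * q ^ 2 := abs_excProb_sub_le hw0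
  -- The power `K` brings the mixing rate below `3 / 4`, and the equation for `l` reads `(3 / 4) ^ l
  -- = l / n`.
  have hpow : (1 - gap) ^ (K * ⌈l⌉₊) ≤ l / n := by
    have h1 : (1 - gap) ^ (K * ⌈l⌉₊) ≤ (3 / 4 : ℝ) ^ ⌈l⌉₊ := by
      rw [pow_mul]
      exact pow_le_pow_left₀ (pow_nonneg (by linarith) _) hK _
    have h2 : (3 / 4 : ℝ) ^ ⌈l⌉₊ ≤ (3 / 4 : ℝ) ^ l := by
      rw [← Real.rpow_natCast]
      exact Real.rpow_le_rpow_of_exponent_ge (by norm_num) (by norm_num) (Nat.le_ceil l)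
    have h3 : (3 / 4 : ℝ) ^ l = l / n := by
      rw [Real.rpow_neg (by norm_num)] at hl
      have hpos : 0 < (3 / 4 : ℝ) ^ l := Real.rpow_pos_of_pos (by norm_num) _
      rw [eq_div_iff hn0.ne', ← hl]
      field_simp
    linarith
  have hm : ((K * ⌈l⌉₊ : ℕ) : ℝ) ≤ 3 * K * l := by
    have := (Nat.ceil_lt_add_one (by linarith : 0 ≤ l)).le
    push_cast
    have h3 : (⌈l⌉₊ : ℝ) ≤ 3 * l := by linarith
    calc (K : ℝ) * ⌈l⌉₊ ≤ K * (3 * l) := by gcongr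
      _ = _ := by ring
  -- Here `360 = 72 * 5`, `5700 = 76 * 3 * 25`, and `24` comes from `12 q² ≤ 24 l q²` with `12 = 2 *
  -- 4 + 4`.
  have hstep : stepError (u n r) (K * ⌈l⌉₊) q
      ≤ 360 * (l / n) * q + (5700 * K + 24) * l * q ^ 2 := by
    unfold stepError
    have hpow0 : 0 ≤ (1 - gap) ^ (K * ⌈l⌉₊) := pow_nonneg (by linarith) _
    have t1 : 72 * (1 - gap) ^ (K * ⌈l⌉₊) * excProb (u n r) ≤ 72 * (l / n) * (5 * q) := by gcongr
    have t2 : 76 * ((K * ⌈l⌉₊ : ℕ) : ℝ) * excProb (u n r) ^ 2 ≤ 76 * (3 * K * l) * (5 * q) ^ 2 := by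
      gcongr
    have t3 : 12 * q ^ 2 ≤ 24 * l * q ^ 2 := by
      have : 0 ≤ q ^ 2 := by positivity
      nlinarith
    nlinarith
  have hmin0 : 0 < min r (r ^ 2) := by positivity
  have m1 : 1 / r ≤ 1 / min r (r ^ 2) := one_div_le_one_div_of_le hmin0 (min_le_left _ _)
  have m2 : 1 / r ^ 2 ≤ 1 / min r (r ^ 2) := one_div_le_one_div_of_le hmin0 (min_le_right _ _)
  calc n * stepError (u n r) (K * ⌈l⌉₊) q
      ≤ n * (360 * (l / n) * q + (5700 * K + 24) * l * q ^ 2) := by gcongr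
    _ = 360 * (1 / r * (l / n)) + (5700 * K + 24) * (1 / r ^ 2 * (l / n)) := by
        rw [hq, hw]
        field_simp
    _ ≤ 360 * (1 / min r (r ^ 2) * (l / n)) +
        (5700 * K + 24) * (1 / min r (r ^ 2) * (l / n)) := by gcongr
    _ = _ := by ring

end

end NICF

theorem theorem1p6 (l : ℕ → ℝ)
    (hl : ∀ n : ℕ, 1 ≤ n → l n * (3 / 4 : ℝ) ^ (-(l n)) = (n : ℝ)) :
    ∃ C : ℝ, 0 < C ∧ ∀ n : ℕ, 1 ≤ n → ∀ r : ℝ, 0 < r →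
      (∀ j : ℕ,
        |NICF.mu.real {x | x ∈ NICF.X ∧ NICF.S n x (NICF.u n r) = j}
            - Real.exp (-(1 / r)) * ((1 / r) ^ j / (j.factorial : ℝ))|
          ≤ C * (1 / min r (r ^ 2) * (l n / n))) ∧
      (∀ k : ℕ, 1 ≤ k → k ≤ n →
        |NICF.mu.real {x | x ∈ NICF.X ∧ (NICF.Mk k n x : ℝ) ≤ NICF.u n r}
            - Real.exp (-(1 / r)) *
                ∑ j ∈ Finset.range k, (1 / r) ^ j / (j.factorial : ℝ)|
          ≤ C * (1 / min r (r ^ 2) * (l n / n))) ∧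
      |NICF.mu.real {x | x ∈ NICF.X ∧ (NICF.M n x : ℝ) ≤ NICF.u n r}
          - Real.exp (-(1 / r))|
        ≤ C * (1 / min r (r ^ 2) * (l n / n)) := by
  obtain ⟨K, hK⟩ := NICF.exists_gap_pow_le
  refine ⟨5700 * K + 384, by positivity, fun n hn r hr => ?_⟩
  have hn0 : (0 : ℝ) < n := by exact_mod_cast hn
  have hu : 0 ≤ NICF.u n r := by
    have := NICF.log_goldenRatio_pos
    unfold NICF.u
    positivity
  set q : NNReal := NNReal.mk (1 / (n * r)) (by positivity) with hq
  have hnq : (((n : NNReal) * q : NNReal) : ℝ) = 1 / r := by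
    rw [NNReal.coe_mul, NNReal.coe_natCast, hq, NNReal.coe_mk]
    field_simp
  have key : ∀ A : Set ℕ, |NICF.mu.real {x | x ∈ NICF.X ∧ NICF.S n x (NICF.u n r) ∈ A} -
      (ProbabilityTheory.poissonMeasure (n * q)).real A| ≤
      (5700 * K + 384) * (1 / min r (r ^ 2) * (l n / n)) := fun A =>
    (NICF.abs_measureReal_sub_poissonMeasure_le _ (K * ⌈l n⌉₊) n q A).trans
      (NICF.stepError_le hK hn hr (hl n hn))
  have hlt : ∀ k : ℕ, |NICF.mu.real {x | x ∈ NICF.X ∧ NICF.S n x (NICF.u n r) < k} -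
      Real.exp (-(1 / r)) * ∑ j ∈ Finset.range k, (1 / r) ^ j / (j.factorial : ℝ)| ≤
      (5700 * K + 384) * (1 / min r (r ^ 2) * (l n / n)) := by
    intro k
    have := key (Set.Iio k)
    rwa [NICF.poissonMeasure_real_Iio, hnq] at this
  refine ⟨fun j => ?_, fun k hk hkn => ?_, ?_⟩
  · have := key {j}
    rwa [ProbabilityTheory.poissonMeasure_real_singleton, hnq, mul_div_assoc] at this
  · simp only [NICF.Mk_le_iff hk hkn]
    exact hlt k
  · simp only [NICF.M_le_iff hu]
    simpa using hlt 1
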